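/- Let $\mathcal P$ be the ring of simple polytopes: the free abelian group on the combinatorial types of simple convex polytopes (addition is formal disjoint union), with direct product as multiplication, and let $d$ be the linear operator sending a polytope to the sum of its facets (with $d(\mathrm{pt})=0$), extended coefficientwise to $(\mathcal P\otimes\mathbb Q)[[x,y]]$. For a finite connected graph $\Gamma$ with node set $V$, let $P(\Gamma)=\sum_{S}\Delta_S\subset\mathbb R^V$ be its nestohedron, the Minkowski sum over all nonempty $S\subseteq V$ whose induced subgraph is connected, where $\Delta_S=\mathrm{conv}\{e_i : i\in S\}$. Let $Pe^n=P(K_{n+1})$ be the nestohedron of the complete graph on $n+1$ nodes, let $P_{\nabla^k,\because^l}$ be the nestohedron of the join of the complete graph on $k$ nodes and the edgeless graph on $l$ nodes, and let $P_{\because^k,\because^l}=P(K_{k,l})$ be the nestohedron of the complete bipartite graph (the join of two edgeless graphs). Put $$Pe(x)=\sum_{n\ge 0}Pe^n\frac{x^{n+1}}{(n+1)!},\qquad P_{\nabla,\because}(x,y)=\sum_{k\ge 1}\sum_{l\ge 0}P_{\nabla^k,\because^l}\frac{x^k}{k!}\frac{y^l}{l!},$$ $$P_{\because,\because}(x,y)=\sum_{\substack{k,l\ge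 0\\ K_{k,l}\ \text{connected}}}P_{\because^k,\because^l}\frac{x^k}{k!}\frac{y^l}{l!},$$ where $K_{k,l}$ is connected exactly for $k,l\ge 1$ and for $(k,l)\in\{(1,0),(0,1)\}$. Then all coefficients of these three series lie in $\mathcal P\otimes\mathbb Q$, and $$dP_{\because,\because}(x,y)=x\,P_{\nabla,\because}(y,x)+y\,P_{\nabla,\because}(x,y)+P_{\because,\because}(x,y)\,Pe(x+y)-(x+y)\,Pe(x+y).$$ -/

import Mathlib

open scoped Pointwise Nat

noncomputable section

namespace Nestohedra

/-! ### Convex polytopes and their faces -/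

/-- A (nonempty) convex polytope: the convex hull of a finite nonempty set of points in a real
vector space. -/
structure Polytope : Type 1 where
  E : Type
  [addCommGroup : AddCommGroup E]
  [module : Module ℝ E]
  carrier : Set E
  nonempty : carrier.Nonempty
  exists_eq_convexHull : ∃ s : Set E, s.Finite ∧ carrier = convexHull ℝ s

attribute [instance] Polytope.addCommGroup Polytope.module

namespace Polytope

theorem convex (P : Polytope) : Convex ℝ P.carrier := by
  obtain ⟨s, -, h⟩ := P.exists_eq_convexHull
  rw [h]
  exact convex_convexHull ℝ s

/-- The nonempty faces of a polytope: its nonempty convex extreme subsets. The polytope itself is a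
face. -/
def IsFace (P : Polytope) (F : Set P.E) : Prop :=
  F.Nonempty ∧ Convex ℝ F ∧ IsExtreme ℝ P.carrier F

/-- The poset of nonempty faces, ordered by inclusion. -/
abbrev Face (P : Polytope) : Type := {F : Set P.E // P.IsFace F}

instance (P : Polytope) : OrderTop P.Face where
  top := ⟨P.carrier, P.nonempty, P.convex, IsExtreme.refl ℝ _⟩
  le_top F := F.2.2.2.subset

theorem isFace_eq_convexHull {E : Type} [AddCommGroup E] [Module ℝ E] {s F : Set E}
    (hF : Convex ℝ F) (hext : IsExtreme ℝ (convexHull ℝ s) F) :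
    F = convexHull ℝ (s ∩ F) := by
  have hsub : convexHull ℝ (s ∩ F) ⊆ F := convexHull_min Set.inter_subset_right hF
  have hdiff : convexHull ℝ (s \ F) ⊆ convexHull ℝ s \ F :=
    convexHull_min (fun x hx => ⟨subset_convexHull ℝ s hx.1, hx.2⟩)
      (hext.convex_sdiff (convex_convexHull ℝ s))
  refine Set.Subset.antisymm (fun x hx => ?_) hsub
  have hxs := hext.subset hx
  rcases (s ∩ F).eq_empty_or_nonempty with h1 | h1
  · have h2 : s \ F = s := by
      ext y
      refine ⟨fun h => h.1, fun h => ⟨h, fun hy => ?_⟩⟩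
      have : y ∈ s ∩ F := ⟨h, hy⟩
      rw [h1] at this
      exact this
    rw [h2] at hdiff
    exact absurd hx (hdiff hxs).2
  rcases (s \ F).eq_empty_or_nonempty with h2 | h2
  · have : s ∩ F = s := Set.inter_eq_left.2 (Set.sdiff_eq_empty.1 h2)
    rwa [this]
  rw [← Set.inter_union_sdiff s F, convexHull_union h1 h2, mem_convexJoin] at hxs
  obtain ⟨a, ha, b, hb, hab⟩ := hxs
  rw [← insert_endpoints_openSegment] at hab
  rcases hab with rfl | rfl | hab
  · exact ha
  · exact absurd hx (hdiff hb).2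
  · exact absurd (hext.right_mem_of_mem_openSegment (hext.subset (hsub ha)) (hdiff hb).1 hx hab)
      (hdiff hb).2

instance (P : Polytope) : Finite P.Face := by
  obtain ⟨s, hs, h⟩ := P.exists_eq_convexHull
  have : Finite (s.powerset) := hs.powerset.to_subtype
  refine Finite.of_injective (β := s.powerset) (fun F => ⟨s ∩ F.1, Set.inter_subset_left⟩) ?_
  intro F G hFG
  have hFG' : s ∩ F.1 = s ∩ G.1 := congrArg Subtype.val hFG
  apply Subtype.ext
  rw [isFace_eq_convexHull F.2.2.1 (h ▸ F.2.2.2), hFG',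
    ← isFace_eq_convexHull G.2.2.1 (h ▸ G.2.2.2)]

/-- A face is itself a polytope. -/
def ofFace (P : Polytope) (F : P.Face) : Polytope where
  E := P.E
  carrier := F.1
  nonempty := F.2.1
  exists_eq_convexHull := by
    obtain ⟨s, hs, h⟩ := P.exists_eq_convexHull
    exact ⟨s ∩ F.1, hs.subset Set.inter_subset_left,
      isFace_eq_convexHull F.2.2.1 (h ▸ F.2.2.2)⟩

/-- The faces of a face `F` are the faces contained in `F`. -/
def ofFaceOrderIso (P : Polytope) (F : P.Face) : (P.ofFace F).Face ≃o Set.Iic F where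
  toFun G := ⟨⟨G.1, G.2.1, G.2.2.1, F.2.2.2.trans G.2.2.2⟩, G.2.2.2.subset⟩
  invFun G := ⟨G.1.1, G.1.2.1, G.1.2.2.1, G.1.2.2.2.mono F.2.2.2.subset G.2⟩
  left_inv _ := rfl
  right_inv _ := rfl
  map_rel_iff' := Iff.rfl

/-- The facets of a polytope: its maximal proper faces. (A point has none.) -/
abbrev Facet (P : Polytope) : Type := {F : P.Face // IsCoatom F}

instance (P : Polytope) : Fintype P.Facet := Fintype.ofFinite _

/-- The dimension of (the affine hull of) a polytope. -/
def dim (P : Polytope) : ℕ := Module.finrank ℝ (vectorSpan ℝ P.carrier)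

/-- A polytope of dimension `n` is simple if each of its vertices lies in exactly `n` facets. -/
def IsSimple (P : Polytope) : Prop :=
  ∀ v ∈ P.carrier.extremePoints ℝ, Nat.card {F : P.Facet // v ∈ F.1.1} = P.dim

/-- Two polytopes are combinatorially equivalent if their face posets are isomorphic. -/
instance setoid : Setoid Polytope where
  r P Q := Nonempty (P.Face ≃o Q.Face)
  iseqv :=
    ⟨fun _ => ⟨OrderIso.refl _⟩, fun ⟨e⟩ => ⟨e.symm⟩, fun ⟨e⟩ ⟨f⟩ => ⟨e.trans f⟩⟩

/-- The one-point polytope. -/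
def point : Polytope where
  E := PUnit
  carrier := Set.univ
  nonempty := Set.univ_nonempty
  exists_eq_convexHull := ⟨Set.univ, Set.finite_univ, convexHull_univ.symm⟩

/-- The direct product of two polytopes. -/
def prod (P Q : Polytope) : Polytope where
  E := P.E × Q.E
  carrier := P.carrier ×ˢ Q.carrier
  nonempty := P.nonempty.prod Q.nonempty
  exists_eq_convexHull := by
    obtain ⟨s, hs, h⟩ := P.exists_eq_convexHull
    obtain ⟨t, ht, h'⟩ := Q.exists_eq_convexHull
    exact ⟨s ×ˢ t, hs.prod ht, by rw [convexHull_prod, h, h']⟩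

theorem IsFace.prod {P Q : Polytope} {F : Set P.E} {G : Set Q.E} (hF : P.IsFace F)
    (hG : Q.IsFace G) : (P.prod Q).IsFace (F ×ˢ G) := by
  refine ⟨hF.1.prod hG.1, hF.2.1.prod hG.2.1, Set.prod_mono hF.2.2.subset hG.2.2.subset, ?_⟩
  rintro ⟨x₁, x₂⟩ hx ⟨y₁, y₂⟩ hy ⟨z₁, z₂⟩ hz ⟨a, b, ha, hb, hab, h⟩
  obtain ⟨h₁, h₂⟩ := Prod.ext_iff.1 h
  exact ⟨hF.2.2.left_mem_of_mem_openSegment hx.1 hy.1 hz.1 ⟨a, b, ha, hb, hab, h₁⟩,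
    hG.2.2.left_mem_of_mem_openSegment hx.2 hy.2 hz.2 ⟨a, b, ha, hb, hab, h₂⟩⟩

theorem swap_mem {P Q : Polytope} {H : Set (P.E × Q.E)} (hH : (P.prod Q).IsFace H)
    {x₁ y₁ : P.E} {x₂ y₂ : Q.E} (hx : (x₁, x₂) ∈ H) (hy : (y₁, y₂) ∈ H) : (x₁, y₂) ∈ H := by
  have hx' : (x₁, x₂) ∈ P.carrier ×ˢ Q.carrier := hH.2.2.subset hx
  have hy' : (y₁, y₂) ∈ P.carrier ×ˢ Q.carrier := hH.2.2.subset hy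
  have hm : ((1 / 2 : ℝ) • (x₁, x₂) + (1 / 2 : ℝ) • (y₁, y₂) : P.E × Q.E) ∈ H :=
    hH.2.1 hx hy (by norm_num) (by norm_num) (by norm_num)
  have h1 : ((x₁, y₂) : P.E × Q.E) ∈ P.carrier ×ˢ Q.carrier := ⟨hx'.1, hy'.2⟩
  have h2 : ((y₁, x₂) : P.E × Q.E) ∈ P.carrier ×ˢ Q.carrier := ⟨hy'.1, hx'.2⟩
  refine hH.2.2.left_mem_of_mem_openSegment h1 h2 hm
    ⟨1 / 2, 1 / 2, by norm_num, by norm_num, by norm_num, ?_⟩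
  exact Prod.ext rfl (add_comm _ _)

theorem isFace_prod_iff {P Q : Polytope} {H : Set (P.E × Q.E)} (hH : (P.prod Q).IsFace H) :
    P.IsFace (Prod.fst '' H) ∧ Q.IsFace (Prod.snd '' H) ∧
      (Prod.fst '' H) ×ˢ (Prod.snd '' H) = H := by
  have hprod : (Prod.fst '' H) ×ˢ (Prod.snd '' H) = H := by
    ext ⟨a, b⟩
    constructor
    · rintro ⟨⟨⟨a', c⟩, h1, rfl⟩, ⟨⟨d, b'⟩, h2, rfl⟩⟩
      exact swap_mem hH h1 h2
    · intro h
      exact ⟨⟨_, h, rfl⟩, ⟨_, h, rfl⟩⟩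
  refine ⟨⟨hH.1.image _, hH.2.1.linear_image (LinearMap.fst ℝ P.E Q.E), ?_, ?_⟩,
    ⟨hH.1.image _, hH.2.1.linear_image (LinearMap.snd ℝ P.E Q.E), ?_, ?_⟩, hprod⟩
  · rintro _ ⟨x, hx, rfl⟩
    exact (hH.2.2.subset hx).1
  · rintro x hx y hy _ ⟨⟨z, w⟩, hz, rfl⟩ ⟨a, b, ha, hb, hab, h⟩
    have hw : w ∈ Q.carrier := (hH.2.2.subset hz).2
    refine ⟨(x, w), hH.2.2.left_mem_of_mem_openSegment (x := (x, w)) (y := (y, w)) ⟨hx, hw⟩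
      ⟨hy, hw⟩ hz ⟨a, b, ha, hb, hab, Prod.ext h ?_⟩, rfl⟩
    exact (add_smul a b w).symm.trans (by rw [hab, one_smul])
  · rintro _ ⟨x, hx, rfl⟩
    exact (hH.2.2.subset hx).2
  · rintro x hx y hy _ ⟨⟨w, z⟩, hz, rfl⟩ ⟨a, b, ha, hb, hab, h⟩
    have hw : w ∈ P.carrier := (hH.2.2.subset hz).1
    refine ⟨(w, x), hH.2.2.left_mem_of_mem_openSegment (x := (w, x)) (y := (w, y)) ⟨hw, hx⟩
      ⟨hw, hy⟩ hz ⟨a, b, ha, hb, hab, Prod.ext ?_ h⟩, rfl⟩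
    exact (add_smul a b w).symm.trans (by rw [hab, one_smul])

/-- The faces of a product are the products of faces. -/
def prodFaceIso (P Q : Polytope) : (P.prod Q).Face ≃o P.Face × Q.Face where
  toFun H := (⟨_, (isFace_prod_iff H.2).1⟩, ⟨_, (isFace_prod_iff H.2).2.1⟩)
  invFun FG := ⟨FG.1.1 ×ˢ FG.2.1, FG.1.2.prod FG.2.2⟩
  left_inv H := Subtype.ext (isFace_prod_iff H.2).2.2
  right_inv FG := Prod.ext (Subtype.ext (Set.fst_image_prod _ FG.2.2.1))
    (Subtype.ext (Set.snd_image_prod FG.1.2.1 _))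
  map_rel_iff' {H K} := by
    constructor
    · rintro ⟨h1, h2⟩
      change H.1 ⊆ K.1
      rw [← (isFace_prod_iff H.2).2.2, ← (isFace_prod_iff K.2).2.2]
      exact Set.prod_mono h1 h2
    · intro h
      exact ⟨Set.image_mono h, Set.image_mono h⟩

instance : Unique point.Face where
  default := ⊤
  uniq F := by
    obtain ⟨x, hx⟩ := F.2.1
    exact Subtype.ext (Set.eq_univ_of_forall fun _ => hx)

end Polytope

open Polytope

/-- Order isomorphisms of the factors induce one of the products. -/
def prodCongrIso {α β γ δ : Type} [Preorder α] [Preorder β] [Preorder γ] [Preorder δ]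
    (e : α ≃o β) (f : γ ≃o δ) : α × γ ≃o β × δ where
  toEquiv := e.toEquiv.prodCongr f.toEquiv
  map_rel_iff' := and_congr e.le_iff_le f.le_iff_le

/-- A one-element factor of a product can be dropped. -/
def uniqueProdIso (α β : Type) [Preorder α] [Unique α] [Preorder β] : α × β ≃o β where
  toEquiv := Equiv.uniqueProd β α
  map_rel_iff' {a b} := ⟨fun h => ⟨(Subsingleton.elim a.1 b.1).le, h⟩, fun h => h.2⟩

/-! ### The ring of polytopes and the boundary operator -/

/-- Combinatorial types of polytopes. -/
def PolytopeType : Type 1 := Quotient Polytope.setoid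

/-- The combinatorial type of a polytope. -/
def PolytopeType.of (P : Polytope) : PolytopeType := Quotient.mk _ P

/-- Combinatorial types form a commutative monoid under direct product, with unit the point. -/
instance : CommMonoid PolytopeType where
  one := Quotient.mk _ point
  mul := Quotient.map₂ Polytope.prod fun P P' ⟨e⟩ Q Q' ⟨f⟩ =>
    ⟨(prodFaceIso P Q).trans ((prodCongrIso e f).trans (prodFaceIso P' Q').symm)⟩
  mul_assoc a b c := Quotient.inductionOn₃ a b c fun P Q R => Quotient.sound
    ⟨(prodFaceIso (P.prod Q) R).trans <| (prodCongrIso (prodFaceIso P Q) (OrderIso.refl _)).trans <|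
      (OrderIso.prodAssoc _ _ _).trans <|
      (prodCongrIso (OrderIso.refl _) (prodFaceIso Q R).symm).trans (prodFaceIso P (Q.prod R)).symm⟩
  one_mul a := Quotient.inductionOn a fun P => Quotient.sound
    ⟨(prodFaceIso point P).trans (uniqueProdIso _ _)⟩
  mul_one a := Quotient.inductionOn a fun P => Quotient.sound
    ⟨(prodFaceIso P point).trans (OrderIso.prodComm.trans (uniqueProdIso _ _))⟩
  mul_comm a b := Quotient.inductionOn₂ a b fun P Q => Quotient.sound
    ⟨(prodFaceIso P Q).trans (OrderIso.prodComm.trans (prodFaceIso Q P).symm)⟩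

/-- The ring of polytopes with rational coefficients: the free `ℚ`-module on the combinatorial
types of polytopes (addition is formal disjoint union), with direct product as multiplication. -/
abbrev PolytopeRing : Type 1 := MonoidAlgebra ℚ PolytopeType

/-- The class of a polytope in the ring of polytopes. -/
def cls (P : Polytope) : PolytopeRing := MonoidAlgebra.single (PolytopeType.of P) 1

/-- The ring `𝒫 ⊗ ℚ` of simple polytopes, as a subring of the ring of all polytopes: the
subalgebra generated by the classes of simple polytopes. -/
def simplePolytopeRing : Subalgebra ℚ PolytopeRing :=
  Algebra.adjoin ℚ {c | ∃ P : Polytope, P.IsSimple ∧ c = cls P}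

/-- The sum of the classes of all facets of a polytope. -/
def facetSum (P : Polytope) : PolytopeRing := ∑ F : P.Facet, cls (P.ofFace F.1)

theorem facetSum_congr (P Q : Polytope) (h : P ≈ Q) : facetSum P = facetSum Q := by
  obtain ⟨e⟩ := h
  refine Fintype.sum_equiv (e.toEquiv.subtypeEquiv fun F => (e.isCoatom_iff F).symm) _ _ ?_
  intro F
  refine congrArg (fun c => MonoidAlgebra.single c (1 : ℚ)) (Quotient.sound ⟨?_⟩)
  refine (P.ofFaceOrderIso F.1).trans (OrderIso.trans ?_ (Q.ofFaceOrderIso (e F.1)).symm)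
  exact
    { toEquiv := e.toEquiv.subtypeEquiv fun G => (e.le_iff_le (x := G) (y := F.1)).symm
      map_rel_iff' := fun {a b} => e.le_iff_le (x := a.1) (y := b.1) }

/-- The sum of the classes of all facets, as a function of the combinatorial type. -/
def PolytopeType.facetSum (c : PolytopeType) : PolytopeRing :=
  Quotient.lift Nestohedra.facetSum facetSum_congr c

/-- The boundary operator `d`: the linear map sending a polytope to the disjoint union (formal sum)
of its facets. -/
def boundary : PolytopeRing →ₗ[ℚ] PolytopeRing :=
  Finsupp.linearCombination ℚ PolytopeType.facetSum ∘ₗ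
    (MonoidAlgebra.coeffLinearEquiv ℚ).toLinearMap

/-! ### Nestohedra -/

/-- A building set on a finite set `V`. -/
structure BuildingSet (V : Type) [DecidableEq V] where
  sets : Finset (Finset V)
  nonempty_of_mem : ∀ S ∈ sets, S.Nonempty
  union_mem : ∀ S ∈ sets, ∀ T ∈ sets, (S ∩ T).Nonempty → S ∪ T ∈ sets
  singleton_mem : ∀ i : V, {i} ∈ sets

open Classical in
/-- The graphical building set: all nonempty vertex sets that induce a connected subgraph. -/
def graphicalBuildingSet {V : Type} [Fintype V] [DecidableEq V] (G : SimpleGraph V) :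
    BuildingSet V where
  sets := {S : Finset V | S.Nonempty ∧ (G.induce (S : Set V)).Connected}
  nonempty_of_mem S hS := (Finset.mem_filter.1 hS).2.1
  union_mem S hS T hT h := by
    rw [Finset.mem_filter] at hS hT ⊢
    refine ⟨Finset.mem_univ _, hS.2.1.mono Finset.subset_union_left, ?_⟩
    rw [Finset.coe_union]
    refine SimpleGraph.induce_union_connected hS.2.2.preconnected hT.2.2.preconnected ?_
    rw [← Finset.coe_inter]
    exact Finset.coe_nonempty.2 h
  singleton_mem i := by
    rw [Finset.mem_filter]
    refine ⟨Finset.mem_univ _, Finset.singleton_nonempty i, ?_⟩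
    rw [Finset.coe_singleton]
    exact { preconnected := .of_subsingleton }

/-- The simplex spanned by the standard basis vectors `e_i`, `i ∈ S`. -/
def stdFace {V : Type} [DecidableEq V] (S : Finset V) : Set (V → ℝ) :=
  convexHull ℝ ((fun i => Pi.single i (1 : ℝ)) '' (S : Set V))

/-- The nestohedron of a building set: the Minkowski sum of the simplices of its members. -/
def nestohedron {V : Type} [Fintype V] [DecidableEq V] (B : BuildingSet V) : Polytope where
  E := V → ℝ
  carrier := ∑ S ∈ B.sets, stdFace S
  nonempty := by
    refine Finset.sum_induction _ Set.Nonempty (fun _ _ => Set.Nonempty.add) ⟨0, rfl⟩ ?_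
    intro S hS
    exact (((Finset.coe_nonempty.2 (B.nonempty_of_mem S hS))).image _).convexHull
  exists_eq_convexHull := by
    refine ⟨∑ S ∈ B.sets, (fun i => Pi.single i (1 : ℝ)) '' (S : Set V), ?_, ?_⟩
    · exact Finset.sum_induction _ Set.Finite (fun _ _ => Set.Finite.add) (Set.finite_singleton 0)
        fun S _ => (Finset.finite_toSet S).image _
    · rw [convexHull_sum]
      rfl

/-- The class of the nestohedron of a graph. -/
def graphCls {V : Type} [Fintype V] [DecidableEq V] (G : SimpleGraph V) : PolytopeRing :=
  cls (nestohedron (graphicalBuildingSet G))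

/-! ### The families -/

/-- The join of two graphs: the disjoint union with all edges between the two parts added. -/
def join {V W : Type} (G : SimpleGraph V) (H : SimpleGraph W) : SimpleGraph (V ⊕ W) :=
  (G ⊕g H) ⊔ completeBipartiteGraph V W

/-- The join of two edgeless graphs, i.e. the complete bipartite graph `K_{k,l}`. -/
abbrev emptyJoinEmpty (k l : ℕ) : SimpleGraph (Fin k ⊕ Fin l) := join ⊥ ⊥

/-- The join of the complete graph on `k` nodes and the edgeless graph on `l` nodes. -/
abbrev completeJoinEmpty (k l : ℕ) : SimpleGraph (Fin k ⊕ Fin l) := join ⊤ ⊥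

/-- `(𝒫 ⊗ ℚ)[[x, y]]`; the variables are `x = X 0` and `y = X 1`. -/
abbrev Series : Type 1 := MvPowerSeries (Fin 2) PolytopeRing

/-- The variable `x`. -/
abbrev varX : Series := MvPowerSeries.X 0

/-- The variable `y`. -/
abbrev varY : Series := MvPowerSeries.X 1

/-- The permutohedra series `Pe(x) = ∑_{n ≥ 0} Pe^n x^{n+1} / (n+1)!`, where `Pe^n` is the
nestohedron of the complete graph on `n + 1` nodes. -/
def seriesPe : PowerSeries PolytopeRing := PowerSeries.mk fun
  | 0 => 0
  | n + 1 => ((n + 1)! : ℚ)⁻¹ • graphCls (⊤ : SimpleGraph (Fin (n + 1)))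

/-- The series of the joins of a (nonempty) complete graph and an edgeless graph:
the sum over `k ≥ 1`, `l ≥ 0`. -/
def seriesCE : Series := fun m =>
  if 1 ≤ m 0 then
    ((m 0)! * (m 1)! : ℚ)⁻¹ • graphCls (completeJoinEmpty (m 0) (m 1))
  else 0

open Classical in
/-- The series of the complete bipartite graphs: the sum over all `k, l ≥ 0` for which `K_{k,l}`
is connected, i.e. over `k, l ≥ 1` and `(k, l) = (1, 0), (0, 1)`. -/
def seriesEE : Series := fun m =>
  if (emptyJoinEmpty (m 0) (m 1)).Connected then
    ((m 0)! * (m 1)! : ℚ)⁻¹ • graphCls (emptyJoinEmpty (m 0) (m 1))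
  else 0

/-- The boundary operator, extended coefficientwise to power series. -/
def seriesBoundary (f : Series) : Series := fun m => boundary (MvPowerSeries.coeff m f)

/-- The substitution `f(x, y) ↦ f(a, b)`. -/
def evalAt (f : Series) (a b : Series) : Series := MvPowerSeries.subst ![a, b] f

end Nestohedra

end

open Nestohedra

/-! For a building set `B` with `univ ∈ B.sets`, the faces of the nestohedron are governed by nested
sets. The nestohedron is cut out by one equation and the inequalities `countBelow B S ≤ ∑ i ∈ S, x
i`, `S ∈ B.sets` (`mem_nestohedron_iff_countBelow_le`). Sending a face to the members whose
inequality is tight on it identifies the face poset with the nested sets under reverse inclusion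
(`nestedFaceIso`). Facets are then the proper members `S` of `B`, and each vertex lies on `|V| - 1`
of them, which is the dimension, so the polytope is simple (`isSimple_nestohedron`).

The faces of the facet of `S` are the nested sets containing `S`. Such a nested set splits uniquely
into one of the restriction to `S` and one of the contraction by `S` (`nestedSets_link`), so the
facet is combinatorially the product of two smaller nestohedra (`cls_facet`).

For `K_{k,l}` with `k, l ≥ 1` the members are the single nodes and the sets that meet both parts.
Contracting a single node makes the opposite part complete and leaves the rest of its own part
edgeless; contracting a set that meets both parts leaves a complete graph. Counting the sets by the
sizes of their two traces gives binomial coefficients, which is multiplication of exponential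
generating series. The single nodes give the terms with factor `x` and `y`. The other sets give the
product of `Pe(x+y)` with the bipartite series without its two one-node terms, whence the correction
`-(x+y) Pe(x+y)`. -/

namespace Nestohedra

open Polytope

/-! ### Nested sets -/

/-- A family `N` is nested with respect to `𝓑` if no union of members of `N` is in `𝓑`, except for
trivial reasons. -/
def IsNested {V : Type} [DecidableEq V] (𝓑 N : Finset (Finset V)) : Prop :=
  ∀ M ⊆ N, M.Nonempty → M.sup id ∈ 𝓑 → M.sup id ∈ M

/-- The nested subfamilies of `𝓑` that do not contain the ground set `G`. -/
abbrev NestedSets {V : Type} [DecidableEq V] (𝓑 : Finset (Finset V)) (G : Finset V) : Type :=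
  {N : Finset (Finset V) // N ⊆ 𝓑.erase G ∧ IsNested 𝓑 N}

/-! ### Nested sets under injections of the ground set. -/

section Relabel

variable {V W : Type} [DecidableEq V] [DecidableEq W]

theorem sup_id_map (f : W ↪ V) (M : Finset (Finset W)) :
    (M.map (Finset.mapEmbedding f).toEmbedding).sup id = (M.sup id).map f := by
  ext x
  simp only [Finset.mem_sup, Finset.mem_map, id]
  constructor
  · rintro ⟨_, ⟨T, hT, rfl⟩, hx⟩
    obtain ⟨y, hy, rfl⟩ := Finset.mem_map.1 hx
    exact ⟨y, ⟨T, hT, hy⟩, rfl⟩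
  · rintro ⟨y, ⟨T, hT, hy⟩, rfl⟩
    exact ⟨_, ⟨T, hT, rfl⟩, Finset.mem_map_of_mem f hy⟩

theorem isNested_map_iff (f : W ↪ V) (𝓑 N : Finset (Finset W)) :
    IsNested (𝓑.map (Finset.mapEmbedding f).toEmbedding)
      (N.map (Finset.mapEmbedding f).toEmbedding) ↔ IsNested 𝓑 N := by
  have key : ∀ (A : Finset (Finset W)) (T : Finset W),
      T.map f ∈ A.map (Finset.mapEmbedding f).toEmbedding ↔ T ∈ A := fun A T =>
    Finset.mem_map' (Finset.mapEmbedding f).toEmbedding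
  constructor
  · intro h M hM hne hB
    have := h _ (Finset.map_subset_map.2 hM) (hne.map (f := (Finset.mapEmbedding f).toEmbedding))
    rw [sup_id_map, key, key] at this
    exact this hB
  · intro h M hM hne hB
    obtain ⟨M, hM', rfl⟩ := Finset.subset_map_iff.1 hM
    rw [sup_id_map, key] at hB ⊢
    exact h M hM' (Finset.map_nonempty.1 hne) hB

/-- Nested sets are transported along injections of the ground sets. -/
theorem nestedSets_map (f : W ↪ V) (𝓑 : Finset (Finset W)) (G : Finset W) :
    Nonempty (NestedSets 𝓑 G ≃o
      NestedSets (𝓑.map (Finset.mapEmbedding f).toEmbedding) (G.map f)) := by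
  have herase : (𝓑.map (Finset.mapEmbedding f).toEmbedding).erase (G.map f) =
      (𝓑.erase G).map (Finset.mapEmbedding f).toEmbedding :=
    (Finset.map_erase (Finset.mapEmbedding f).toEmbedding 𝓑 G).symm
  let e : NestedSets 𝓑 G ↪o
      NestedSets (𝓑.map (Finset.mapEmbedding f).toEmbedding) (G.map f) :=
    OrderEmbedding.ofMapLEIff (fun N => ⟨N.1.map (Finset.mapEmbedding f).toEmbedding, by
      rw [herase]; exact ⟨Finset.map_subset_map.2 N.2.1, (isNested_map_iff f 𝓑 N.1).2 N.2.2⟩⟩)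
      (fun _ _ => Finset.map_subset_map)
  refine ⟨RelIso.ofSurjective e ?_⟩
  rintro ⟨N, hN, hN'⟩
  rw [herase] at hN
  obtain ⟨N, hM', rfl⟩ := Finset.subset_map_iff.1 hN
  exact ⟨⟨N, hM', (isNested_map_iff f 𝓑 N).1 hN'⟩, rfl⟩

end Relabel

/-! ### Nested sets containing a given member: restriction and contraction. -/

section Link

variable {V : Type} [DecidableEq V]

/-- The members of `𝓑` contained in `S`. -/
def restriction (𝓑 : Finset (Finset V)) (S : Finset V) : Finset (Finset V) :=
  𝓑.filter (· ⊆ S)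

/-- The nonempty differences `T \ S`, `T ∈ 𝓑`, for a building set `𝓑` that contains `S`. -/
def contraction [Fintype V] (𝓑 : Finset (Finset V)) (S : Finset V) : Finset (Finset V) :=
  Sᶜ.powerset.filter fun T => T.Nonempty ∧ (T ∈ 𝓑 ∨ T ∪ S ∈ 𝓑)

theorem mem_restriction {𝓑 : Finset (Finset V)} {S T : Finset V} :
    T ∈ restriction 𝓑 S ↔ T ∈ 𝓑 ∧ T ⊆ S := Finset.mem_filter

theorem mem_contraction [Fintype V] {𝓑 : Finset (Finset V)} {S T : Finset V} :
    T ∈ contraction 𝓑 S ↔ Disjoint T S ∧ T.Nonempty ∧ (T ∈ 𝓑 ∨ T ∪ S ∈ 𝓑) := by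
  rw [contraction, Finset.mem_filter, Finset.mem_powerset, Finset.subset_compl_iff_disjoint_right]

/-- Nestedness for the family `{S, T}`. In a building set the union of two overlapping members is a
member, so overlapping members of a nested set are comparable. -/
theorem IsNested.union_mem_imp {𝓑 N : Finset (Finset V)} (h : IsNested 𝓑 N) {S T : Finset V}
    (hS : S ∈ N) (hT : T ∈ N) (hST : S ∪ T ∈ 𝓑) : T ⊆ S ∨ S ⊆ T := by
  have := h {S, T} (by simp [Finset.insert_subset_iff, hS, hT]) (by simp) (by simpa using hST)
  simpa using this

/-- The member of `𝓑` from which an element of the contraction by `S` arises canonically. -/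
def liftSet (𝓑 : Finset (Finset V)) (S T : Finset V) : Finset V :=
  if T ∪ S ∈ 𝓑 then T ∪ S else T

theorem liftSet_sdiff {𝓑 : Finset (Finset V)} {S T : Finset V} (h : Disjoint T S) :
    liftSet 𝓑 S T \ S = T := by
  unfold liftSet
  split_ifs
  · rw [Finset.union_sdiff_right, Finset.sdiff_eq_self_of_disjoint h]
  · exact Finset.sdiff_eq_self_of_disjoint h

theorem liftSet_subset_union (𝓑 : Finset (Finset V)) (S T : Finset V) :
    liftSet 𝓑 S T ⊆ T ∪ S := by
  unfold liftSet
  split_ifs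
  · exact subset_rfl
  · exact Finset.subset_union_left

theorem subset_liftSet (𝓑 : Finset (Finset V)) (S T : Finset V) : T ⊆ liftSet 𝓑 S T := by
  unfold liftSet
  split_ifs
  · exact Finset.subset_union_left
  · exact subset_rfl

theorem liftSet_mem [Fintype V] {𝓑 : Finset (Finset V)} {S T : Finset V}
    (h : T ∈ contraction 𝓑 S) : liftSet 𝓑 S T ∈ 𝓑 := by
  unfold liftSet
  split_ifs with h'
  · exact h'
  · exact (mem_contraction.1 h).2.2.resolve_right h'

theorem liftSet_not_subset [Fintype V] {𝓑 : Finset (Finset V)} {S T : Finset V}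
    (h : T ∈ contraction 𝓑 S) : ¬ liftSet 𝓑 S T ⊆ S := by
  obtain ⟨h1, ⟨x, hx⟩, -⟩ := mem_contraction.1 h
  exact fun h2 => Finset.disjoint_left.1 h1 hx (h2 (subset_liftSet 𝓑 S T hx))

/-- A member `T` of a nested set through `S` that is not inside `S` either contains `S`, or is
disjoint from `S` with `T ∪ S` outside the building set. These are the two branches of `liftSet`, so
`T` can be recovered from `T \ S`. -/
theorem liftSet_sdiff_eq [Fintype V] (B : BuildingSet V) {S T : Finset V} {N : Finset (Finset V)}
    (hN : N ⊆ B.sets) (hnest : IsNested B.sets N) (hS : S ∈ N) (hT : T ∈ N) (hTS : ¬ T ⊆ S) :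
    T \ S ∈ contraction B.sets S ∧ liftSet B.sets S (T \ S) = T := by
  have hne : (T \ S).Nonempty := Finset.sdiff_nonempty.2 hTS
  by_cases hd : Disjoint T S
  · have h1 : T \ S = T := Finset.sdiff_eq_self_of_disjoint hd
    rw [h1]
    refine ⟨mem_contraction.2 ⟨hd, h1 ▸ hne, Or.inl (hN hT)⟩, if_neg fun h => ?_⟩
    rcases hnest.union_mem_imp hT hS h with h | h
    · obtain ⟨x, hx⟩ := B.nonempty_of_mem S (hN hS)
      exact Finset.disjoint_left.1 hd (h hx) hx
    · exact hTS h
  · have hU : T ∪ S ∈ B.sets := B.union_mem T (hN hT) S (hN hS)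
      (Finset.not_disjoint_iff_nonempty_inter.1 hd)
    have hST : S ⊆ T := (hnest.union_mem_imp hT hS hU).resolve_right hTS
    have hU' : T \ S ∪ S = T := Finset.sdiff_union_of_subset hST
    refine ⟨mem_contraction.2 ⟨Finset.sdiff_disjoint, hne, Or.inr (hU'.symm ▸ hN hT)⟩, ?_⟩
    rw [liftSet, hU', if_pos (hN hT)]

theorem sup_image_liftSet_sdiff [Fintype V] {𝓑 : Finset (Finset V)} {S : Finset V}
    {M : Finset (Finset V)} (hM : M ⊆ contraction 𝓑 S) :
    (M.image (liftSet 𝓑 S)).sup id \ S = M.sup id := by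
  ext x
  simp only [Finset.mem_sdiff, Finset.mem_sup, Finset.mem_image, id]
  constructor
  · rintro ⟨⟨_, ⟨T, hT, rfl⟩, hx⟩, hxS⟩
    have := Finset.mem_union.1 (liftSet_subset_union 𝓑 S T hx)
    exact ⟨T, hT, this.resolve_right hxS⟩
  · rintro ⟨T, hT, hx⟩
    exact ⟨⟨_, ⟨T, hT, rfl⟩, subset_liftSet _ _ _ hx⟩,
      Finset.disjoint_left.1 (mem_contraction.1 (hM hT)).1 hx⟩

/-- Glueing nested sets of the restriction and of the contraction. -/
def glue (𝓑 : Finset (Finset V)) (S : Finset V) (N₁ N₂ : Finset (Finset V)) :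
    Finset (Finset V) :=
  insert S (N₁ ∪ N₂.image (liftSet 𝓑 S))

/-- A union of glued members that stays inside `S` is handled by the restriction, or equals `S`.
Otherwise its part outside `S` is a union of members of `N₂`, so nestedness in the contraction
applies, and the lift of that part is the original union. -/
theorem isNested_glue [Fintype V] (B : BuildingSet V) {S : Finset V} (hS : S ∈ B.sets)
    {N₁ N₂ : Finset (Finset V)} (h₁ : N₁ ⊆ restriction B.sets S)
    (h₁' : IsNested (restriction B.sets S) N₁) (h₂ : N₂ ⊆ contraction B.sets S)
    (h₂' : IsNested (contraction B.sets S) N₂) : IsNested B.sets (glue B.sets S N₁ N₂) := by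
  intro M hM hne hB
  by_cases hMS : ∀ T ∈ M, T ⊆ S
  · have hsub : M.sup id ⊆ S := Finset.sup_le hMS
    by_cases hSM : S ∈ M
    · have : M.sup id = S := hsub.antisymm (Finset.le_sup (f := id) hSM)
      rwa [this]
    · refine h₁' M (fun T hT => ?_) hne (mem_restriction.2 ⟨hB, hsub⟩)
      rcases Finset.mem_insert.1 (hM hT) with rfl | h
      · exact absurd hT hSM
      rcases Finset.mem_union.1 h with h | h
      · exact h
      · obtain ⟨T', hT', rfl⟩ := Finset.mem_image.1 h
        exact absurd (hMS _ hT) (liftSet_not_subset (h₂ hT'))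
  push Not at hMS
  obtain ⟨T₀, hT₀, hT₀S⟩ := hMS
  set M' := N₂.filter (fun T => liftSet B.sets S T ∈ M) with hM'
  have hMsplit : ∀ T ∈ M, ¬ T ⊆ S → ∃ T' ∈ M', liftSet B.sets S T' = T := by
    intro T hT hTS
    rcases Finset.mem_insert.1 (hM hT) with rfl | h
    · exact absurd subset_rfl hTS
    rcases Finset.mem_union.1 h with h | h
    · exact absurd (mem_restriction.1 (h₁ h)).2 hTS
    · obtain ⟨T', hT', rfl⟩ := Finset.mem_image.1 h
      exact ⟨T', Finset.mem_filter.2 ⟨hT', hT⟩, rfl⟩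
  have hsup : M'.sup id = M.sup id \ S := by
    ext x
    simp only [Finset.mem_sdiff, Finset.mem_sup, id]
    constructor
    · rintro ⟨T, hT, hx⟩
      have hT' := Finset.mem_filter.1 hT
      exact ⟨⟨_, hT'.2, subset_liftSet _ _ _ hx⟩,
        Finset.disjoint_left.1 (mem_contraction.1 (h₂ hT'.1)).1 hx⟩
    · rintro ⟨⟨T, hT, hx⟩, hxS⟩
      obtain ⟨T', hT', rfl⟩ := hMsplit T hT fun h => hxS (h hx)
      exact ⟨T', hT', (Finset.mem_union.1 (liftSet_subset_union _ _ _ hx)).resolve_right hxS⟩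
  have hM'ne : M'.Nonempty := by
    obtain ⟨T', hT', -⟩ := hMsplit T₀ hT₀ hT₀S
    exact ⟨T', hT'⟩
  have hUne : (M.sup id \ S).Nonempty := by
    obtain ⟨x, hx, hxS⟩ := Finset.not_subset.1 hT₀S
    exact ⟨x, Finset.mem_sdiff.2 ⟨Finset.mem_sup.2 ⟨T₀, hT₀, hx⟩, hxS⟩⟩
  -- This dichotomy both places the trace outside `S` in the contraction and decides the branch of
  -- `liftSet` in `heq`.
  have hcase : Disjoint (M.sup id) S ∨ M.sup id ∪ S ∈ B.sets := by
    by_cases hd : Disjoint (M.sup id) S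
    · exact Or.inl hd
    · exact Or.inr (B.union_mem _ hB S hS (Finset.not_disjoint_iff_nonempty_inter.1 hd))
  have hmem : M'.sup id ∈ contraction B.sets S := by
    rw [hsup, mem_contraction]
    refine ⟨Finset.sdiff_disjoint, hUne, ?_⟩
    rcases hcase with h | h
    · exact Or.inl (by rwa [Finset.sdiff_eq_self_of_disjoint h])
    · exact Or.inr (by rwa [Finset.sdiff_union_self_eq_union])
  have hU := h₂' M' (Finset.filter_subset _ _) hM'ne hmem
  have hlift := (Finset.mem_filter.1 hU).2
  rw [hsup] at hlift
  have hle : liftSet B.sets S (M.sup id \ S) ⊆ M.sup id := Finset.le_sup (f := id) hlift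
  have heq : liftSet B.sets S (M.sup id \ S) = M.sup id := by
    refine hle.antisymm ?_
    unfold liftSet
    split_ifs with h
    · rw [Finset.sdiff_union_self_eq_union]
      exact Finset.subset_union_left
    · rw [Finset.sdiff_union_self_eq_union] at h
      rw [Finset.sdiff_eq_self_of_disjoint (hcase.resolve_right h)]
  rwa [heq] at hlift

/-- Let `U` be the union of the family in the contraction. If `U ∪ S` is in the building set,
nestedness of `N` is applied to the lifts together with `S`; if not, to the lifts alone, whose union
is then `U` itself. -/
theorem isNested_contraction [Fintype V] (B : BuildingSet V) {S : Finset V}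
    {N : Finset (Finset V)} (hN : IsNested B.sets N) (hSN : S ∈ N) :
    IsNested (contraction B.sets S)
      ((contraction B.sets S).filter (fun T => liftSet B.sets S T ∈ N)) := by
  intro M hM hne hB
  have hMc : M ⊆ contraction B.sets S := hM.trans (Finset.filter_subset _ _)
  have hMN : M.image (liftSet B.sets S) ⊆ N := by
    intro T hT
    obtain ⟨T', hT', rfl⟩ := Finset.mem_image.1 hT
    exact (Finset.mem_filter.1 (hM hT')).2
  have hsup := sup_image_liftSet_sdiff hMc
  have key : ∀ T ∈ M.image (liftSet B.sets S), T \ S = M.sup id → M.sup id ∈ M := by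
    intro T hT h
    obtain ⟨T', hT', rfl⟩ := Finset.mem_image.1 hT
    rw [liftSet_sdiff (mem_contraction.1 (hMc hT')).1] at h
    exact h ▸ hT'
  obtain ⟨hd, hUne, hU⟩ := mem_contraction.1 hB
  by_cases hUS : M.sup id ∪ S ∈ B.sets
  · have hs : (insert S (M.image (liftSet B.sets S))).sup id = M.sup id ∪ S := by
      rw [Finset.sup_insert, ← hsup, Finset.sdiff_union_self_eq_union]
      exact Finset.union_comm _ _
    have := hN _ (Finset.insert_subset hSN hMN) (Finset.insert_nonempty _ _) (hs ▸ hUS)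
    rw [hs] at this
    rcases Finset.mem_insert.1 this with h | h
    · obtain ⟨x, hx⟩ := hUne
      exact absurd (h ▸ Finset.mem_union_left S hx) (Finset.disjoint_left.1 hd hx)
    · exact key _ h (by rw [Finset.union_sdiff_right, Finset.sdiff_eq_self_of_disjoint hd])
  · have hUB := hU.resolve_right hUS
    -- No lift here contains `S`: if `T ∪ S` were a member with `∅ ≠ T ⊆ U`, its union with the
    -- member `U` would be `U ∪ S`.
    have himg : (M.image (liftSet B.sets S)).sup id = M.sup id := by
      rw [← hsup, eq_comm, Finset.sdiff_eq_self_iff_disjoint, Finset.disjoint_sup_left]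
      intro U hU'
      obtain ⟨T, hT, rfl⟩ := Finset.mem_image.1 hU'
      have hTd := (mem_contraction.1 (hMc hT)).1
      have hTne := (mem_contraction.1 (hMc hT)).2.1
      have hTle : T ⊆ M.sup id := Finset.le_sup (f := id) hT
      rw [id, liftSet, if_neg]
      · exact hTd
      · intro h
        apply hUS
        have := B.union_mem _ hUB _ h
          (hTne.mono (Finset.subset_inter hTle Finset.subset_union_left))
        rwa [← Finset.union_assoc, Finset.union_eq_left.2 hTle] at this
    have := hN _ hMN (hne.image _) (himg ▸ hUB)
    rw [himg] at this
    exact key _ this (Finset.sdiff_eq_self_of_disjoint hd)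

/-- The nested sets containing `S` are the pairs of nested sets of the restriction to `S` and of the
contraction by `S`. -/
theorem nestedSets_link [Fintype V] (B : BuildingSet V) (hV : Finset.univ ∈ B.sets)
    {S : Finset V} (hS : S ∈ B.sets) (hSV : S ≠ Finset.univ) :
    Nonempty (NestedSets (restriction B.sets S) S × NestedSets (contraction B.sets S) Sᶜ ≃o
      {N : NestedSets B.sets Finset.univ // S ∈ N.1}) := by
  -- Both factors are read off from the glued family, as the members strictly inside `S` and the
  -- sets whose lift occurs. Hence glueing reflects the order.
  have hmem : ∀ (N₁ : NestedSets (restriction B.sets S) S)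
      (N₂ : NestedSets (contraction B.sets S) Sᶜ) (T : Finset V),
      (T ∈ N₁.1 ↔ T ∈ glue B.sets S N₁.1 N₂.1 ∧ T ⊂ S) ∧
      (T ∈ N₂.1 ↔ T ∈ contraction B.sets S ∧ liftSet B.sets S T ∈ glue B.sets S N₁.1 N₂.1) := by
    intro N₁ N₂ T
    have h₁ : ∀ T ∈ N₁.1, T ⊂ S := fun T hT => by
      have := Finset.mem_erase.1 (N₁.2.1 hT)
      exact (mem_restriction.1 this.2).2.ssubset_of_ne this.1
    have h₂ : ∀ T ∈ N₂.1, T ∈ contraction B.sets S := fun T hT =>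
      Finset.mem_of_mem_erase (N₂.2.1 hT)
    constructor
    · refine ⟨fun h => ⟨Finset.mem_insert_of_mem (Finset.mem_union_left _ h), h₁ T h⟩, ?_⟩
      rintro ⟨h, hTS⟩
      rcases Finset.mem_insert.1 h with rfl | h
      · exact absurd hTS (ssubset_irrefl _)
      rcases Finset.mem_union.1 h with h | h
      · exact h
      · obtain ⟨T', hT', rfl⟩ := Finset.mem_image.1 h
        exact absurd hTS.subset (liftSet_not_subset (h₂ _ hT'))
    · refine ⟨fun h => ⟨h₂ T h, Finset.mem_insert_of_mem (Finset.mem_union_right _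
        (Finset.mem_image_of_mem _ h))⟩, ?_⟩
      rintro ⟨hT, h⟩
      have hns := liftSet_not_subset hT
      rcases Finset.mem_insert.1 h with h | h
      · exact absurd h.subset hns
      rcases Finset.mem_union.1 h with h | h
      · exact absurd (h₁ _ h).subset hns
      · obtain ⟨T', hT', hTT'⟩ := Finset.mem_image.1 h
        rw [← liftSet_sdiff (𝓑 := B.sets) (mem_contraction.1 hT).1, ← hTT',
          liftSet_sdiff (mem_contraction.1 (h₂ _ hT')).1]
        exact hT'
  let e : NestedSets (restriction B.sets S) S × NestedSets (contraction B.sets S) Sᶜ ↪o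
      {N : NestedSets B.sets Finset.univ // S ∈ N.1} :=
    OrderEmbedding.ofMapLEIff (fun N => ⟨⟨glue B.sets S N.1.1 N.2.1, by
        intro T hT
        rcases Finset.mem_insert.1 hT with rfl | h
        · exact Finset.mem_erase.2 ⟨hSV, hS⟩
        rcases Finset.mem_union.1 h with h | h
        · have := mem_restriction.1 (Finset.mem_of_mem_erase (N.1.2.1 h))
          exact Finset.mem_erase.2 ⟨fun h => hSV (Finset.univ_subset_iff.1 (h ▸ this.2)), this.1⟩
        · obtain ⟨T', hT', rfl⟩ := Finset.mem_image.1 h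
          have h3 := Finset.mem_erase.1 (N.2.2.1 hT')
          refine Finset.mem_erase.2 ⟨fun h => h3.1 ?_, liftSet_mem h3.2⟩
          rw [← liftSet_sdiff (𝓑 := B.sets) (mem_contraction.1 h3.2).1, h,
            Finset.compl_eq_univ_sdiff],
      isNested_glue B hS (N.1.2.1.trans (Finset.erase_subset _ _)) N.1.2.2
        (N.2.2.1.trans (Finset.erase_subset _ _)) N.2.2.2⟩, Finset.mem_insert_self _ _⟩) (by
      intro N N'
      constructor
      · intro h
        constructor
        · intro T hT
          have := ((hmem N.1 N.2 T).1.1 hT)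
          exact (hmem N'.1 N'.2 T).1.2 ⟨h this.1, this.2⟩
        · intro T hT
          have := ((hmem N.1 N.2 T).2.1 hT)
          exact (hmem N'.1 N'.2 T).2.2 ⟨this.1, h this.2⟩
      · intro h
        exact Finset.insert_subset_insert S
          (Finset.union_subset_union h.1 (Finset.image_subset_image h.2)))
  refine ⟨RelIso.ofSurjective e ?_⟩
  rintro ⟨⟨N, hN, hN'⟩, hSN⟩
  have hNB : N ⊆ B.sets := hN.trans (Finset.erase_subset _ _)
  refine ⟨⟨⟨N.filter (· ⊂ S), fun T hT => ?_, ?_⟩,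
    ⟨(contraction B.sets S).filter (fun T => liftSet B.sets S T ∈ N), fun T hT => ?_,
      isNested_contraction B hN' hSN⟩⟩, ?_⟩
  · have := Finset.mem_filter.1 hT
    exact Finset.mem_erase.2 ⟨this.2.ne, mem_restriction.2 ⟨hNB this.1, this.2.subset⟩⟩
  · intro M hM hne hB
    exact hN' M (hM.trans (Finset.filter_subset _ _)) hne (mem_restriction.1 hB).1
  · have := Finset.mem_filter.1 hT
    refine Finset.mem_erase.2 ⟨?_, this.1⟩
    -- As `univ` is in the building set, `Sᶜ` lifts to `univ`, which `N` omits.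
    rintro rfl
    rw [liftSet, Finset.union_comm, Finset.union_compl, if_pos hV] at this
    exact (Finset.mem_erase.1 (hN this.2)).1 rfl
  · apply Subtype.ext
    apply Subtype.ext
    ext T
    change T ∈ glue _ _ _ _ ↔ T ∈ N
    simp only [glue, Finset.mem_insert, Finset.mem_union, Finset.mem_image, Finset.mem_filter]
    constructor
    · rintro (rfl | h | ⟨T', hT', rfl⟩)
      · exact hSN
      · exact h.1
      · exact hT'.2
    · intro hT
      by_cases h1 : T = S
      · exact Or.inl h1
      by_cases h2 : T ⊆ S
      · exact Or.inr (Or.inl ⟨hT, h2.ssubset_of_ne h1⟩)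
      · have := liftSet_sdiff_eq B hNB hN' hSN hT h2
        exact Or.inr (Or.inr ⟨T \ S, ⟨this.1, this.2.symm ▸ hT⟩, this.2⟩)

end Link

section

variable {V : Type} [DecidableEq V]

/-! ### The inequalities of a nestohedron -/

theorem single_mem_stdFace {T : Finset V} {i : V} (hi : i ∈ T) :
    (Pi.single i 1 : V → ℝ) ∈ stdFace T :=
  subset_convexHull ℝ _ ⟨i, hi, rfl⟩

/-- The number of members of a building set contained in a set, as a real number. -/
def countBelow (B : BuildingSet V) (A : Finset V) : ℝ := ∑ T ∈ B.sets, if T ⊆ A then 1 else 0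

/-- A member `S ⊆ A` of largest size absorbs every member of the building set that lies in `A` and
meets `S`, by the union axiom. So `countBelow` is additive over `S` and `A \ S`, and induction
applies to `A \ S`. -/
theorem countBelow_le_of_forall_mem (B : BuildingSet V) {x : V → ℝ}
    (hx : ∀ S ∈ B.sets, countBelow B S ≤ ∑ i ∈ S, x i) (A : Finset V) :
    countBelow B A ≤ ∑ i ∈ A, x i := by
  induction A using Finset.strongInduction with
  | _ A ih =>
    rcases A.eq_empty_or_nonempty with rfl | ⟨a, ha⟩
    · rw [Finset.sum_empty]
      refine (Finset.sum_eq_zero fun T hT => if_neg fun h => ?_).le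
      exact (B.nonempty_of_mem T hT).ne_empty (Finset.subset_empty.1 h)
    obtain ⟨S, hS, hmax⟩ := Finset.exists_max_image (B.sets.filter (· ⊆ A)) Finset.card
      ⟨{a}, Finset.mem_filter.2 ⟨B.singleton_mem a, Finset.singleton_subset_iff.2 ha⟩⟩
    obtain ⟨hSB, hSA⟩ := Finset.mem_filter.1 hS
    have hsplit : countBelow B A = countBelow B S + countBelow B (A \ S) := by
      rw [countBelow, countBelow, countBelow, ← Finset.sum_add_distrib]
      refine Finset.sum_congr rfl fun T hT => ?_
      have hTne := B.nonempty_of_mem T hT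
      by_cases hTA : T ⊆ A
      · by_cases hd : Disjoint T S
        · have h1 : ¬ T ⊆ S := fun h => hTne.ne_empty (Finset.disjoint_self_iff_empty T |>.1
            (hd.mono_right h))
          have h2 : T ⊆ A \ S := Finset.subset_sdiff.2 ⟨hTA, hd⟩
          simp [hTA, h1, h2]
        · have hU := B.union_mem S hSB T hT (by
            rw [Finset.inter_comm]; exact Finset.not_disjoint_iff_nonempty_inter.1 hd)
          have hle := hmax _ (Finset.mem_filter.2 ⟨hU, Finset.union_subset hSA hTA⟩)
          have h1 : T ⊆ S := by
            rw [Finset.eq_of_subset_of_card_le Finset.subset_union_left hle]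
            exact Finset.subset_union_right
          have h2 : ¬ T ⊆ A \ S := fun h => hd (Finset.subset_sdiff.1 h).2
          simp [hTA, h1, h2]
      · have h1 : ¬ T ⊆ S := fun h => hTA (h.trans hSA)
        have h2 : ¬ T ⊆ A \ S := fun h => hTA (h.trans Finset.sdiff_subset)
        simp [hTA, h1, h2]
    rw [hsplit, ← Finset.sum_sdiff hSA, add_comm]
    exact add_le_add (ih _ (Finset.sdiff_ssubset hSA (B.nonempty_of_mem S hSB))) (hx S hSB)

variable [Fintype V]

theorem mem_stdFace {T : Finset V} {y : V → ℝ} :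
    y ∈ stdFace T ↔ (∀ i, 0 ≤ y i) ∧ (∀ i ∉ T, y i = 0) ∧ ∑ i, y i = 1 := by
  constructor
  · intro hy
    have hconv : Convex ℝ {y : V → ℝ | (∀ i, 0 ≤ y i) ∧ (∀ i ∉ T, y i = 0) ∧ ∑ i, y i = 1} := by
      rintro a ⟨ha1, ha2, ha3⟩ b ⟨hb1, hb2, hb3⟩ s t hs ht hst
      refine ⟨fun i => ?_, fun i hi => ?_, ?_⟩
      · exact add_nonneg (mul_nonneg hs (ha1 i)) (mul_nonneg ht (hb1 i))
      · simp [ha2 i hi, hb2 i hi]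
      · simp only [Pi.add_apply, Pi.smul_apply, smul_eq_mul, Finset.sum_add_distrib,
          ← Finset.mul_sum, ha3, hb3, mul_one, hst]
    refine convexHull_min ?_ hconv hy
    rintro _ ⟨i, hi, rfl⟩
    refine ⟨fun j => ?_, fun j hj => ?_, by simp⟩
    · by_cases h : j = i
      · subst h; simp
      · simp [h]
    · exact Pi.single_eq_of_ne (fun h : j = i => hj (h ▸ hi)) _
  · rintro ⟨h1, h2, h3⟩
    have hy : y = ∑ i ∈ T, y i • Pi.single i (1 : ℝ) := by
      funext j
      rw [Finset.sum_apply]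
      by_cases hj : j ∈ T
      · rw [Finset.sum_eq_single_of_mem j hj]
        · simp
        · intro i _ hij
          simp [hij.symm]
      · rw [h2 j hj, Finset.sum_eq_zero]
        intro i hi
        have : j ≠ i := fun h => hj (h ▸ hi)
        simp [this]
    rw [hy]
    refine (convex_convexHull ℝ _).sum_mem (fun i _ => h1 i) ?_
      (fun i hi => subset_convexHull ℝ _ ⟨i, hi, rfl⟩)
    rw [← h3]
    exact Finset.sum_subset (Finset.subset_univ T) fun i _ hi => h2 i hi

theorem mem_nestohedron {B : BuildingSet V} {x : V → ℝ} :
    x ∈ (nestohedron B).carrier ↔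
      ∃ y : Finset V → V → ℝ, (∀ T ∈ B.sets, y T ∈ stdFace T) ∧ ∑ T ∈ B.sets, y T = x := by
  change x ∈ ∑ S ∈ B.sets, stdFace S ↔ _
  rw [Set.mem_finsetSum]
  constructor
  · rintro ⟨g, hg, h⟩
    exact ⟨g, fun T hT => hg hT, h⟩
  · rintro ⟨g, hg, h⟩
    exact ⟨g, fun hT => hg _ hT, h⟩

/-- A single Minkowski summand contributes this bound; summed over the building set, the left sides
give `countBelow B A`. -/
theorem indicator_le_sum_stdFace {T : Finset V} {y : V → ℝ} (hy : y ∈ stdFace T) (A : Finset V) :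
    (if T ⊆ A then 1 else 0) ≤ ∑ i ∈ A, y i := by
  obtain ⟨h1, h2, h3⟩ := mem_stdFace.1 hy
  split_ifs with h
  · rw [← h3]
    exact (Finset.sum_subset (Finset.subset_univ A) fun i _ hi => h2 i fun h' => hi (h h')).ge
  · exact Finset.sum_nonneg fun i _ => h1 i

theorem indicator_eq_sum_stdFace_iff {T : Finset V} {y : V → ℝ} (hy : y ∈ stdFace T)
    (A : Finset V) :
    (if T ⊆ A then 1 else 0) = ∑ i ∈ A, y i ↔ (¬ T ⊆ A → ∀ i ∈ A, y i = 0) := by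
  obtain ⟨h1, h2, h3⟩ := mem_stdFace.1 hy
  split_ifs with h
  · refine iff_of_true ?_ fun h' => absurd h h'
    rw [← h3]
    exact (Finset.sum_subset (Finset.subset_univ A) fun i _ hi => h2 i fun h' => hi (h h')).symm
  · rw [eq_comm, Finset.sum_eq_zero_iff_of_nonneg fun i _ => h1 i]
    exact ⟨fun h _ => h, fun h' => h' h⟩

/-- A sum of termwise bounds is attained only if each one is. This criterion for tightness, in terms
of the summands, underlies all the arguments about nested sets below. -/
theorem sum_sum_eq_countBelow_iff (B : BuildingSet V) {y : Finset V → V → ℝ}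
    (hy : ∀ T ∈ B.sets, y T ∈ stdFace T) (A : Finset V) :
    ∑ i ∈ A, (∑ T ∈ B.sets, y T) i = countBelow B A ↔
      ∀ T ∈ B.sets, ¬ T ⊆ A → ∀ i ∈ A, y T i = 0 := by
  simp only [Finset.sum_apply]
  rw [Finset.sum_comm, countBelow, eq_comm,
    Finset.sum_eq_sum_iff_of_le fun T hT => indicator_le_sum_stdFace (hy T hT) A]
  exact forall₂_congr fun T hT => indicator_eq_sum_stdFace_iff (hy T hT) A

theorem countBelow_le (B : BuildingSet V) {x : V → ℝ} (hx : x ∈ (nestohedron B).carrier)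
    (A : Finset V) : countBelow B A ≤ ∑ i ∈ A, x i := by
  obtain ⟨y, hy, rfl⟩ := mem_nestohedron.1 hx
  simp only [Finset.sum_apply]
  rw [Finset.sum_comm]
  exact Finset.sum_le_sum fun T hT => indicator_le_sum_stdFace (hy T hT) A

theorem sum_eq_countBelow_univ (B : BuildingSet V) {x : V → ℝ}
    (hx : x ∈ (nestohedron B).carrier) : ∑ i, x i = countBelow B Finset.univ := by
  obtain ⟨y, hy, rfl⟩ := mem_nestohedron.1 hx
  exact (sum_sum_eq_countBelow_iff B hy _).2 fun T _ h => absurd (Finset.subset_univ T) h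

/-- A nonnegative weight is a positive combination of indicators of a decreasing chain of sets. The
induction on the size of the support `A` of `w` subtracts the least positive weight from all of `A`
and uses the inequality for `A`. -/
theorem sum_le_sum_mul_of_countBelow_le (B : BuildingSet V) {x : V → ℝ}
    (hx : ∀ A, countBelow B A ≤ ∑ i ∈ A, x i) (n : ℕ) (w : V → ℝ) (m : Finset V → ℝ)
    (hn : (Finset.univ.filter fun i => w i ≠ 0).card ≤ n) (hw : ∀ i, 0 ≤ w i)
    (hm : ∀ T ∈ B.sets, ∀ i ∈ T, m T ≤ w i) :
    ∑ T ∈ B.sets, m T ≤ ∑ i, w i * x i := by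
  induction n generalizing w m with
  | zero =>
    have h0 : ∀ i, w i = 0 := by simpa [Finset.filter_eq_empty_iff] using hn
    simp only [h0, zero_mul, Finset.sum_const_zero]
    refine Finset.sum_nonpos fun T hT => ?_
    obtain ⟨i, hi⟩ := B.nonempty_of_mem T hT
    exact (hm T hT i hi).trans (h0 i).le
  | succ n ih =>
    set A := Finset.univ.filter fun i => w i ≠ 0 with hA
    have hmA : ∀ i, i ∈ A ↔ w i ≠ 0 := fun i => by simp [hA]
    rcases A.eq_empty_or_nonempty with h0 | hne
    · exact ih w m (by rw [← hA, h0]; simp) hw hm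
    obtain ⟨a, ha, hmin⟩ := Finset.exists_min_image A w hne
    have := ih (fun i => w i - w a * if i ∈ A then 1 else 0)
      (fun T => m T - w a * if T ⊆ A then 1 else 0) ?_ ?_ ?_
    · simp only [Finset.sum_sub_distrib, ← Finset.mul_sum, sub_mul, mul_assoc, ite_mul, one_mul,
        zero_mul, Finset.sum_ite_mem, Finset.univ_inter] at this
      have h2 := mul_le_mul_of_nonneg_left (hx A) (hw a)
      rw [countBelow] at h2
      linarith
    · have hlt : (Finset.univ.filter fun i => (w i - w a * if i ∈ A then 1 else 0) ≠ 0) ⊂ A := by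
        refine (Finset.ssubset_iff_of_subset fun i hi => ?_).2 ⟨a, ha, by simp [ha]⟩
        by_contra hiA
        have h0 : w i = 0 := by simpa [hmA] using hiA
        simp [hiA, h0] at hi
      have := Finset.card_lt_card hlt
      omega
    · intro i
      by_cases hi : i ∈ A
      · simpa [hi] using hmin i hi
      · simpa [hi] using hw i
    · intro T hT i hi
      by_cases hTA : T ⊆ A
      · simpa [hTA, hTA hi] using hm T hT i hi
      -- A member not inside the support has a node of weight zero, so `m T ≤ 0`, and nothing has
      -- been subtracted from `m T`.
      · obtain ⟨j, hjT, hjA⟩ := Finset.not_subset.1 hTA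
        have hj : w j = 0 := by simpa [hmA] using hjA
        have h1 := hm T hT j hjT
        have h2 : 0 ≤ w i - w a * if i ∈ A then 1 else 0 := by
          by_cases hi : i ∈ A
          · simpa [hi] using hmin i hi
          · simpa [hi] using hw i
        simp only [hTA, if_false, mul_zero, sub_zero]
        linarith

theorem sum_single_mem_nestohedron (B : BuildingSet V) {c : Finset V → V}
    (hc : ∀ T ∈ B.sets, c T ∈ T) :
    ∑ T ∈ B.sets, (Pi.single (c T) 1 : V → ℝ) ∈ (nestohedron B).carrier :=
  mem_nestohedron.2 ⟨fun T => Pi.single (c T) 1, fun T hT => single_mem_stdFace (hc T hT), rfl⟩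

theorem isClosed_nestohedron (B : BuildingSet V) :
    @IsClosed (V → ℝ) _ (nestohedron B).carrier := by
  obtain ⟨s, hs, h⟩ := (nestohedron B).exists_eq_convexHull
  exact h ▸ Set.Finite.isClosed_convexHull (E := V → ℝ) ℝ hs

/-- If `x` satisfied the inequalities but were outside, some linear `f` would be strictly smaller at
`x` than on the whole nestohedron. Choosing in every simplex a vertex that minimizes `f` gives a
point of the nestohedron at which, by `sum_le_sum_mul_of_countBelow_le`, the value of `f` is at most
`f x`. -/
theorem mem_nestohedron_iff_countBelow_le (B : BuildingSet V) {x : V → ℝ} :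
    x ∈ (nestohedron B).carrier ↔
      ∑ i, x i = countBelow B Finset.univ ∧ ∀ S ∈ B.sets, countBelow B S ≤ ∑ i ∈ S, x i := by
  refine ⟨fun h => ⟨sum_eq_countBelow_univ B h, fun S _ => countBelow_le B h S⟩, ?_⟩
  rintro ⟨h1, h2⟩
  by_contra hx
  obtain ⟨f, u, hfx, hfP⟩ := geometric_hahn_banach_point_closed
    (t := show Set (V → ℝ) from (nestohedron B).carrier) (nestohedron B).convex
    (isClosed_nestohedron B) hx
  have hmin : ∀ T : Finset V, ∃ i, T ∈ B.sets → i ∈ T ∧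
      ∀ j ∈ T, f (Pi.single i 1) ≤ f (Pi.single j 1) := by
    intro T
    by_cases hT : T ∈ B.sets
    · obtain ⟨i, hi, h⟩ := Finset.exists_min_image T (fun i => f (Pi.single i (1 : ℝ)))
        (B.nonempty_of_mem T hT)
      exact ⟨i, fun _ => ⟨hi, h⟩⟩
    · obtain ⟨i⟩ : Nonempty V := by
        by_contra hV
        rw [not_nonempty_iff] at hV
        obtain ⟨y, hy⟩ := (nestohedron B).nonempty
        exact hx ((funext fun i => isEmptyElim i : y = x) ▸ hy)
      exact ⟨i, fun h => absurd h hT⟩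
  choose c hc using hmin
  -- Adding `C` makes the weights nonnegative. It contributes `C * B.sets.card` to both sides, since
  -- that is `C` times the coordinate sum of `x`, and cancels.
  set C := ∑ i, |f (Pi.single i (1 : ℝ))| with hC
  have hC' : ∀ i, -C ≤ f (Pi.single i (1 : ℝ)) := fun i => by
    have := Finset.single_le_sum (f := fun i => |f (Pi.single i (1 : ℝ))|)
      (fun i _ => abs_nonneg _) (Finset.mem_univ i)
    have h3 := neg_abs_le (f (Pi.single i (1 : ℝ)))
    linarith
  have h3 := sum_le_sum_mul_of_countBelow_le B (countBelow_le_of_forall_mem B h2) _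
    (fun i => f (Pi.single i (1 : ℝ)) + C) (fun T => f (Pi.single (c T) (1 : ℝ)) + C) le_rfl
    (fun i => by linarith [hC' i]) (fun T hT i hi => by linarith [(hc T hT).2 i hi])
  have h4 := hfP _ (sum_single_mem_nestohedron B fun T hT => (hc T hT).1)
  have h5 : f x = ∑ i, f (Pi.single i (1 : ℝ)) * x i := by
    conv_lhs => rw [← Finset.univ_sum_single x, map_sum]
    refine Finset.sum_congr rfl fun i _ => ?_
    have : (Pi.single i (x i) : V → ℝ) = x i • Pi.single i (1 : ℝ) := by
      rw [← Pi.single_smul, smul_eq_mul, mul_one]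
    rw [this, map_smul, smul_eq_mul, mul_comm]
  have h6 : countBelow B Finset.univ = B.sets.card := by simp [countBelow]
  rw [map_sum] at h4
  simp only [add_mul, Finset.sum_add_distrib, ← Finset.mul_sum, ← h5, h1, h6, Finset.sum_const,
    nsmul_eq_mul] at h3
  linarith

end

section

variable {V : Type} [DecidableEq V]

/-! ### Faces and nested sets -/

/-- The part of `T` outside the members of `N` that do not contain `T`. -/
def core (N : Finset (Finset V)) (T : Finset V) : Finset V :=
  T \ (N.filter (fun S => ¬ T ⊆ S)).sup id

theorem mem_core {N : Finset (Finset V)} {T : Finset V} {i : V} :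
    i ∈ core N T ↔ i ∈ T ∧ ∀ S ∈ N, i ∈ S → T ⊆ S := by
  simp only [core, Finset.mem_sdiff, Finset.mem_sup, Finset.mem_filter, id, not_exists, not_and,
    and_imp]
  refine and_congr_right fun _ => forall₂_congr fun S _ => ?_
  tauto

theorem core_subset (N : Finset (Finset V)) (T : Finset V) : core N T ⊆ T :=
  Finset.sdiff_subset

theorem union_sup_mem (B : BuildingSet V) {S : Finset V} (hS : S ∈ B.sets)
    (M : Finset (Finset V)) (hM : ∀ T ∈ M, T ∈ B.sets ∧ (T ∩ S).Nonempty) :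
    S ∪ M.sup id ∈ B.sets := by
  induction M using Finset.induction_on with
  | empty => simpa using hS
  | insert T M hT ih =>
    have h1 := ih fun U hU => hM U (Finset.mem_insert_of_mem hU)
    have h2 := hM T (Finset.mem_insert_self _ _)
    rw [Finset.sup_insert, id, Finset.sup_eq_union, Finset.union_left_comm]
    exact B.union_mem T h2.1 _ h1
      (h2.2.mono (Finset.inter_subset_inter_left Finset.subset_union_left))

/-- If the core missed `S`, the members of `N` that meet `S` and do not contain `T` would cover `S`.
Their union would then be in the building set, hence by nestedness be one of them: a member of `N`
containing `S` but not `T`. -/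
theorem core_inter_nonempty (B : BuildingSet V) {N : Finset (Finset V)} (hN : N ⊆ B.sets)
    (hnest : IsNested B.sets N) {S T : Finset V} (hS : S ∈ B.sets) (hST : S ⊆ T)
    (h : ∀ S' ∈ N, S ⊆ S' → T ⊆ S') : (core N T ∩ S).Nonempty := by
  by_contra hcon
  rw [Finset.not_nonempty_iff_eq_empty] at hcon
  set M := N.filter (fun S' => ¬ T ⊆ S' ∧ (S' ∩ S).Nonempty) with hM
  have hSM : S ⊆ M.sup id := by
    intro i hi
    have hi' : i ∉ core N T := fun h' => by
      have : i ∈ core N T ∩ S := Finset.mem_inter.2 ⟨h', hi⟩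
      rw [hcon] at this
      exact Finset.notMem_empty i this
    rw [mem_core] at hi'
    push Not at hi'
    obtain ⟨S', hS', hiS', hTS'⟩ := hi' (hST hi)
    exact Finset.mem_sup.2 ⟨S', Finset.mem_filter.2
      ⟨hS', hTS', ⟨i, Finset.mem_inter.2 ⟨hiS', hi⟩⟩⟩, hiS'⟩
  have hne : M.Nonempty := by
    obtain ⟨i, hi⟩ := B.nonempty_of_mem S hS
    obtain ⟨S', hS', -⟩ := Finset.mem_sup.1 (hSM hi)
    exact ⟨S', hS'⟩
  have hU := union_sup_mem B hS M fun T hT =>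
    ⟨hN (Finset.mem_filter.1 hT).1, (Finset.mem_filter.1 hT).2.2⟩
  rw [Finset.union_eq_right.2 hSM] at hU
  have := hnest M (Finset.filter_subset _ _) hne hU
  have h2 := Finset.mem_filter.1 this
  exact h2.2.1 (h _ h2.1 hSM)

theorem core_nonempty (B : BuildingSet V) {N : Finset (Finset V)} (hN : N ⊆ B.sets)
    (hnest : IsNested B.sets N) {T : Finset V} (hT : T ∈ B.sets) : (core N T).Nonempty :=
  (core_inter_nonempty B hN hnest hT subset_rfl fun _ _ h => h).mono Finset.inter_subset_left

/-- Moving the chosen vertex in one summand only. This serves to separate points of a face and to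
produce directions of the affine hull. -/
theorem sum_single_update (B : BuildingSet V) {c : Finset V → V} {T : Finset V}
    (hT : T ∈ B.sets) (j : V) :
    ∑ U ∈ B.sets, (Pi.single (Function.update c T j U) 1 : V → ℝ) -
      ∑ U ∈ B.sets, Pi.single (c U) 1 = Pi.single j 1 - Pi.single (c T) 1 := by
  rw [← Finset.sum_sub_distrib, Finset.sum_eq_single_of_mem T hT]
  · rw [Function.update_self]
  · intro U _ hU
    rw [Function.update_of_ne hU, sub_self]

variable [Fintype V]

/-- Members of `N` containing the nonempty set `S` overlap, so they form a chain; `T` is its least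
element, or `univ` if the chain is empty. -/
theorem exists_minimal_mem_insert_univ (B : BuildingSet V) {N : Finset (Finset V)}
    (hN : N ⊆ B.sets) (hnest : IsNested B.sets N) {S : Finset V} (hS : S.Nonempty) :
    ∃ T ∈ insert Finset.univ N, S ⊆ T ∧ ∀ S' ∈ N, S ⊆ S' → T ⊆ S' := by
  obtain ⟨T, hT, hmin⟩ := Finset.exists_min_image ((insert Finset.univ N).filter (S ⊆ ·))
    Finset.card ⟨Finset.univ, by simp⟩
  obtain ⟨hTN, hST⟩ := Finset.mem_filter.1 hT
  refine ⟨T, hTN, hST, fun S' hS' hSS' => ?_⟩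
  have hcard := hmin S' (Finset.mem_filter.2 ⟨Finset.mem_insert_of_mem hS', hSS'⟩)
  have key : S' ⊆ T → T ⊆ S' := fun h => (Finset.eq_of_subset_of_card_le h hcard).ge
  rcases Finset.mem_insert.1 hTN with rfl | hTN
  · exact key (Finset.subset_univ _)
  · have hU := B.union_mem T (hN hTN) S' (hN hS') (hS.mono (Finset.subset_inter hST hSS'))
    rcases hnest.union_mem_imp hTN hS' hU with h | h
    · exact key h
    · exact h

open Classical in
/-- The proper members of the building set whose inequality is tight at a point. -/
noncomputable def active (B : BuildingSet V) (x : V → ℝ) : Finset (Finset V) :=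
  (B.sets.erase Finset.univ).filter fun S => ∑ i ∈ S, x i = countBelow B S

theorem mem_active {B : BuildingSet V} {x : V → ℝ} {S : Finset V} :
    S ∈ active B x ↔ S ∈ B.sets.erase Finset.univ ∧ ∑ i ∈ S, x i = countBelow B S := by
  rw [active, Finset.mem_filter]

theorem active_subset (B : BuildingSet V) (x : V → ℝ) : active B x ⊆ B.sets.erase Finset.univ :=
  Finset.filter_subset _ _

/-- If a union `U` of tight sets is a member but none of them, tightness makes the summand of `U`
vanish on each of these sets, hence on `U`, while its coordinates sum to `1`. -/
theorem isNested_active (B : BuildingSet V) {x : V → ℝ} (hx : x ∈ (nestohedron B).carrier) :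
    IsNested B.sets (active B x) := by
  intro M hM hne hU
  by_contra hUM
  obtain ⟨y, hy, rfl⟩ := mem_nestohedron.1 hx
  obtain ⟨-, h2, h3⟩ := mem_stdFace.1 (hy _ hU)
  rw [Finset.sum_eq_zero] at h3
  · exact zero_ne_one h3
  intro i _
  by_cases hi : i ∈ M.sup id
  · obtain ⟨S, hS, hiS⟩ := Finset.mem_sup.1 hi
    refine (sum_sum_eq_countBelow_iff B hy S).1 (mem_active.1 (hM hS)).2 _ hU (fun h => hUM ?_) i
      hiS
    have : M.sup id = S := h.antisymm (Finset.le_sup (f := id) hS)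
    rwa [this]
  · exact h2 i hi

/-- The face of the nestohedron on which the inequalities of the members of `N` are tight. -/
def tightSet (B : BuildingSet V) (N : Finset (Finset V)) : Set (V → ℝ) :=
  {x | x ∈ (nestohedron B).carrier ∧ ∀ S ∈ N, ∑ i ∈ S, x i = countBelow B S}

/-- The core of `T` avoids every `S ∈ N` that does not contain `T`, which is what the tightness
criterion asks of the summand of `T`. -/
theorem sum_mem_tightSet (B : BuildingSet V) {N : Finset (Finset V)} {y : Finset V → V → ℝ}
    (hy : ∀ T ∈ B.sets, y T ∈ stdFace (core N T)) : ∑ T ∈ B.sets, y T ∈ tightSet B N := by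
  have hy' : ∀ T ∈ B.sets, y T ∈ stdFace T := fun T hT => by
    obtain ⟨h1, h2, h3⟩ := mem_stdFace.1 (hy T hT)
    exact mem_stdFace.2 ⟨h1, fun i hi => h2 i fun h => hi (core_subset N T h), h3⟩
  refine ⟨mem_nestohedron.2 ⟨y, hy', rfl⟩, fun S hS => ?_⟩
  rw [sum_sum_eq_countBelow_iff B hy']
  intro T hT hTS i hi
  exact (mem_stdFace.1 (hy T hT)).2.1 i fun h => hTS ((mem_core.1 h).2 S hS hi)

/-- The point is the sum of the barycentres of the simplices on the cores. It is not tight at a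
proper member `S ∉ N`: for the least `T` in `N ∪ {univ}` containing `S`, the core of `T` meets `S`,
so the summand of `T ⊄ S` has positive mass on `S`. -/
theorem exists_active_eq (B : BuildingSet V) (hV : Finset.univ ∈ B.sets) {N : Finset (Finset V)}
    (hN : N ⊆ B.sets.erase Finset.univ) (hnest : IsNested B.sets N) :
    ∃ x ∈ (nestohedron B).carrier, active B x = N := by
  have hNB : N ⊆ B.sets := hN.trans (Finset.erase_subset _ _)
  let y : Finset V → V → ℝ := fun T i => if i ∈ core N T then ((core N T).card : ℝ)⁻¹ else 0
  have hy : ∀ T ∈ B.sets, y T ∈ stdFace (core N T) := by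
    intro T hT
    have hne : ((core N T).card : ℝ) ≠ 0 :=
      Nat.cast_ne_zero.2 (core_nonempty B hNB hnest hT).card_pos.ne'
    refine mem_stdFace.2 ⟨fun i => ?_, fun i hi => if_neg hi, ?_⟩
    · simp only [y]
      split_ifs <;> positivity
    · simp [y, hne]
  have hx := sum_mem_tightSet B hy
  have hy' : ∀ T ∈ B.sets, y T ∈ stdFace T := fun T hT => by
    obtain ⟨h1, h2, h3⟩ := mem_stdFace.1 (hy T hT)
    exact mem_stdFace.2 ⟨h1, fun i hi => h2 i fun h => hi (core_subset N T h), h3⟩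
  refine ⟨_, hx.1, Finset.Subset.antisymm (fun S hS => ?_) fun S hS =>
    mem_active.2 ⟨hN hS, hx.2 S hS⟩⟩
  by_contra hSN
  obtain ⟨hSe, hS⟩ := mem_active.1 hS
  obtain ⟨hSV, hSB⟩ := Finset.mem_erase.1 hSe
  obtain ⟨T, hT, hST, hmin⟩ :=
    exists_minimal_mem_insert_univ B hNB hnest (B.nonempty_of_mem S hSB)
  obtain ⟨i, hi⟩ := core_inter_nonempty B hNB hnest hSB hST hmin
  obtain ⟨hi, hiS⟩ := Finset.mem_inter.1 hi
  have hTB : T ∈ B.sets := by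
    rcases Finset.mem_insert.1 hT with rfl | h
    · exact hV
    · exact hNB h
  have hTS : ¬ T ⊆ S := by
    intro h
    have := h.antisymm hST
    subst this
    rcases Finset.mem_insert.1 hT with h | h
    · exact hSV h
    · exact hSN h
  have h0 := (sum_sum_eq_countBelow_iff B hy' S).1 hS T hTB hTS i hiS
  simp only [y, hi, if_true] at h0
  exact (inv_ne_zero (Nat.cast_ne_zero.2 (Finset.card_pos.2 ⟨i, hi⟩).ne')) h0

theorem isFace_tightSet (B : BuildingSet V) {N : Finset (Finset V)} (h : (tightSet B N).Nonempty) :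
    (nestohedron B).IsFace (tightSet B N) := by
  refine ⟨h, ?_, fun x hx => hx.1, ?_⟩
  · intro (x : V → ℝ) hx (y : V → ℝ) hy a b ha hb hab
    refine ⟨(nestohedron B).convex hx.1 hy.1 ha hb hab, fun S hS => ?_⟩
    change ∑ i ∈ S, (a * x i + b * y i) = _
    rw [Finset.sum_add_distrib, ← Finset.mul_sum, ← Finset.mul_sum, hx.2 S hS, hy.2 S hS,
      ← add_mul, hab, one_mul]
  · rintro (x : V → ℝ) hx (y : V → ℝ) hy _ hz ⟨a, b, ha, hb, hab, rfl⟩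
    refine ⟨hx, fun S hS => ?_⟩
    have h1 : ∑ i ∈ S, (a * x i + b * y i) = _ := hz.2 S hS
    rw [Finset.sum_add_distrib, ← Finset.mul_sum, ← Finset.mul_sum] at h1
    have h2 := countBelow_le B hx S
    have h3 := countBelow_le B hy S
    have h4 : a * ∑ i ∈ S, x i + b * ∑ i ∈ S, y i =
      a * countBelow B S + b * countBelow B S := by rw [h1, ← add_mul, hab, one_mul]
    have h5 := mul_le_mul_of_nonneg_left h3 hb.le
    have h6 : a * ∑ i ∈ S, x i ≤ a * countBelow B S := by linarith
    exact le_antisymm (le_of_mul_le_mul_left h6 ha) h2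

/-- For `y` in the tight set, the segment from `y` to `x` can be prolonged a little beyond `x`:
inequalities tight at `x` are tight at `y` and stay tight, the others have slack at `x`. Thus `x` is
interior to a segment of the polytope ending at `y`, and extremeness puts `y` in `F`. -/
theorem tightSet_subset_of_isFace (B : BuildingSet V) {F : Set (V → ℝ)}
    (hF : (nestohedron B).IsFace F) {x : V → ℝ} (hx : x ∈ F) : tightSet B (active B x) ⊆ F := by
  intro y hy
  have hxP : x ∈ (nestohedron B).carrier := hF.2.2.subset hx
  obtain ⟨hx1, hx2⟩ := (mem_nestohedron_iff_countBelow_le B).1 hxP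
  obtain ⟨hy1, hy2⟩ := (mem_nestohedron_iff_countBelow_le B).1 hy.1
  have hsum : ∀ (ε : ℝ) (S : Finset V), ∑ i ∈ S, (x + ε • (x - y)) i =
      ∑ i ∈ S, x i + ε * (∑ i ∈ S, x i - ∑ i ∈ S, y i) := by
    intro ε S
    simp only [Pi.add_apply, Pi.smul_apply, Pi.sub_apply, smul_eq_mul, Finset.sum_add_distrib,
      ← Finset.mul_sum, Finset.sum_sub_distrib]
  have hev : ∀ S ∈ B.sets, ∀ᶠ ε : ℝ in nhdsWithin 0 (Set.Ioi 0),
      countBelow B S ≤ ∑ i ∈ S, (x + ε • (x - y)) i := by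
    intro S hS
    simp only [hsum]
    by_cases hSx : ∑ i ∈ S, x i = countBelow B S
    · refine Filter.Eventually.of_forall fun ε => ?_
      have : ∑ i ∈ S, y i = countBelow B S := by
        by_cases hSV : S = Finset.univ
        · rw [hSV, hy1]
        · exact hy.2 S (mem_active.2 ⟨Finset.mem_erase.2 ⟨hSV, hS⟩, hSx⟩)
      rw [hSx, this, sub_self, mul_zero, add_zero]
    · have hlt := lt_of_le_of_ne (hx2 S hS) (Ne.symm hSx)
      have hc : Continuous fun ε : ℝ =>
        ∑ i ∈ S, x i + ε * (∑ i ∈ S, x i - ∑ i ∈ S, y i) := by fun_prop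
      have := hc.tendsto 0
      rw [zero_mul, add_zero] at this
      exact nhdsWithin_le_nhds ((this.eventually (lt_mem_nhds hlt)).mono fun _ h => h.le)
  obtain ⟨ε, hε, hε0⟩ :=
    (((Filter.eventually_all_finset B.sets).2 hev).and self_mem_nhdsWithin).exists
  have hε0 : 0 < ε := hε0
  have hz : x + ε • (x - y) ∈ (nestohedron B).carrier := by
    refine (mem_nestohedron_iff_countBelow_le B).2 ⟨?_, hε⟩
    rw [hsum, hx1, hy1, sub_self, mul_zero, add_zero]
  -- The weights solve `x = a • y + b • (x + ε • (x - y))` with `a + b = 1`.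
  refine hF.2.2.left_mem_of_mem_openSegment hy.1 hz hx
    ⟨ε / (1 + ε), 1 / (1 + ε), by positivity, by positivity, by field_simp; ring, ?_⟩
  change (ε / (1 + ε)) • y + (1 / (1 + ε)) • (x + ε • (x - y)) = x
  funext i
  simp only [Pi.add_apply, Pi.smul_apply, Pi.sub_apply, smul_eq_mul]
  field_simp
  ring

/-- A point `x` of `F` with the fewest active members plays the role of a relative interior point.
The midpoint of `x` and `y ∈ F` is active only where both are, so by minimality everything active at
`x` is tight at `y`. -/
theorem exists_eq_tightSet_active (B : BuildingSet V) {F : Set (V → ℝ)}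
    (hF : (nestohedron B).IsFace F) : ∃ x ∈ F, F = tightSet B (active B x) := by
  obtain ⟨x, hx, hmin⟩ : ∃ x ∈ F, ∀ y ∈ F, (active B x).card ≤ (active B y).card := by
    have := (measure fun x : F => (active B x.1).card).wf.has_min Set.univ
      ⟨⟨_, hF.1.some_mem⟩, trivial⟩
    obtain ⟨x, -, h⟩ := this
    exact ⟨x.1, x.2, fun y hy => not_lt.1 (h ⟨y, hy⟩ trivial)⟩
  refine ⟨x, hx, Set.Subset.antisymm (fun y hy => ?_) (tightSet_subset_of_isFace B hF hx)⟩
  have hxP : x ∈ (nestohedron B).carrier := hF.2.2.subset hx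
  have hyP : y ∈ (nestohedron B).carrier := hF.2.2.subset hy
  have hm : (1 / 2 : ℝ) • x + (1 / 2 : ℝ) • y ∈ F :=
    hF.2.1 hx hy (by norm_num) (by norm_num) (by norm_num)
  have htight : ∀ S ∈ active B ((1 / 2 : ℝ) • x + (1 / 2 : ℝ) • y),
      S ∈ active B x ∧ ∑ i ∈ S, y i = countBelow B S := by
    intro S hS
    obtain ⟨hSB, hS⟩ := mem_active.1 hS
    simp only [Pi.add_apply, Pi.smul_apply, smul_eq_mul, Finset.sum_add_distrib,
      ← Finset.mul_sum] at hS
    have h1 := countBelow_le B hxP S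
    have h2 := countBelow_le B hyP S
    exact ⟨mem_active.2 ⟨hSB, by linarith⟩, by linarith⟩
  have heq := Finset.eq_of_subset_of_card_le (fun S hS => (htight S hS).1) (hmin _ hm)
  exact ⟨hyP, fun S hS => (htight S (heq ▸ hS)).2⟩

/-- The nonempty faces of the nestohedron of a connected building set correspond to the nested
sets, ordered by reverse inclusion. -/
def nestedFaceEmbedding (B : BuildingSet V) (hV : Finset.univ ∈ B.sets) :
    (NestedSets B.sets Finset.univ)ᵒᵈ ↪o (nestohedron B).Face :=
  OrderEmbedding.ofMapLEIff
    (fun N => ⟨tightSet B (OrderDual.ofDual N).1, isFace_tightSet B (by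
      obtain ⟨x, hx, h⟩ := exists_active_eq B hV (OrderDual.ofDual N).2.1 (OrderDual.ofDual N).2.2
      exact ⟨x, hx, fun S hS => (mem_active.1 (h ▸ hS)).2⟩)⟩)
    (by
      intro N N'
      constructor
      · intro hle S hS
        obtain ⟨x, hx, h⟩ :=
          exists_active_eq B hV (OrderDual.ofDual N).2.1 (OrderDual.ofDual N).2.2
        have hxN : x ∈ tightSet B (OrderDual.ofDual N).1 :=
          ⟨hx, fun S hS => (mem_active.1 (h ▸ hS)).2⟩
        have := (hle hxN).2 S hS
        change S ∈ (OrderDual.ofDual N).1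
        rw [← h]
        exact mem_active.2 ⟨(OrderDual.ofDual N').2.1 hS, this⟩
      · intro hle x hx
        exact ⟨hx.1, fun S hS => hx.2 S (hle hS)⟩)

/-- The order isomorphism between nested sets, ordered by reverse inclusion, and faces. -/
noncomputable def nestedFaceIso (B : BuildingSet V) (hV : Finset.univ ∈ B.sets) :
    (NestedSets B.sets Finset.univ)ᵒᵈ ≃o (nestohedron B).Face :=
  RelIso.ofSurjective (nestedFaceEmbedding B hV) (by
    rintro ⟨F, hF⟩
    obtain ⟨x, hx, h⟩ := exists_eq_tightSet_active B hF
    exact ⟨OrderDual.toDual ⟨active B x, active_subset B x,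
      isNested_active B (hF.2.2.subset hx)⟩, Subtype.ext h.symm⟩)

theorem mem_nestedFaceIso (B : BuildingSet V) (hV : Finset.univ ∈ B.sets)
    (N : (NestedSets B.sets Finset.univ)ᵒᵈ) (x : V → ℝ) :
    x ∈ (nestedFaceIso B hV N).1 ↔ x ∈ (nestohedron B).carrier ∧
      (OrderDual.ofDual N).1 ⊆ active B x := by
  change (x ∈ (nestohedron B).carrier ∧
    ∀ S ∈ (OrderDual.ofDual N).1, ∑ i ∈ S, x i = countBelow B S) ↔ _
  refine and_congr_right fun _ => forall₂_congr fun S hS => ?_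
  rw [mem_active]
  exact ⟨fun h => ⟨(OrderDual.ofDual N).2.1 hS, h⟩, fun h => h.2⟩

/-! ### Facets and simplicity -/

/-- The nested set with a single member. -/
def singletonNested (B : BuildingSet V) (S : {S // S ∈ B.sets.erase Finset.univ}) :
    NestedSets B.sets Finset.univ :=
  ⟨{S.1}, Finset.singleton_subset_iff.2 S.2, fun M hM hne _ => by
    rw [(Finset.subset_singleton_iff.1 hM).resolve_left hne.ne_empty]
    simp⟩

/-- The order is reversed and the empty nested set is the top face, so coatoms are the minimal
nonempty nested sets. These are the singletons, as any one proper member forms a nested set. -/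
theorem isCoatom_iff_exists (B : BuildingSet V) (hV : Finset.univ ∈ B.sets)
    (F : (nestohedron B).Face) :
    IsCoatom F ↔ ∃ S, nestedFaceIso B hV (OrderDual.toDual (singletonNested B S)) = F := by
  have htop : nestedFaceIso B hV (OrderDual.toDual ⟨∅, Finset.empty_subset _, fun M hM hne => by
      rw [Finset.subset_empty.1 hM] at hne; exact absurd hne Finset.not_nonempty_empty⟩) = ⊤ := by
    apply Subtype.ext
    ext x
    refine (mem_nestedFaceIso B hV _ x).trans ?_
    exact ⟨fun h => h.1, fun h => ⟨h, Finset.empty_subset _⟩⟩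
  obtain ⟨N, rfl⟩ := (nestedFaceIso B hV).surjective F
  constructor
  · intro h
    have hne : (OrderDual.ofDual N).1.Nonempty := by
      rw [Finset.nonempty_iff_ne_empty]
      intro h0
      apply h.1
      rw [← htop]
      exact congrArg _ (Subtype.ext h0)
    obtain ⟨S, hS⟩ := hne
    refine ⟨⟨S, (OrderDual.ofDual N).2.1 hS⟩, ?_⟩
    by_contra hcon
    have hle : nestedFaceIso B hV N ≤
        nestedFaceIso B hV (OrderDual.toDual (singletonNested B ⟨S, (OrderDual.ofDual N).2.1 hS⟩)) :=
      (nestedFaceIso B hV).le_iff_le.2 (Finset.singleton_subset_iff.2 hS)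
    have := h.2 _ (lt_of_le_of_ne hle (Ne.symm hcon))
    rw [← htop] at this
    have h0 := congrArg Subtype.val ((nestedFaceIso B hV).injective this)
    exact Finset.singleton_ne_empty S h0
  · rintro ⟨S, hS⟩
    rw [← hS]
    constructor
    · intro h
      rw [← htop] at h
      exact Finset.singleton_ne_empty S.1 (congrArg Subtype.val ((nestedFaceIso B hV).injective h))
    · intro G hG
      obtain ⟨M, rfl⟩ := (nestedFaceIso B hV).surjective G
      rw [← htop]
      have hlt := (nestedFaceIso B hV).lt_iff_lt.1 hG
      have hsub : (OrderDual.ofDual M).1 ⊆ {S.1} := hlt.le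
      rcases Finset.subset_singleton_iff.1 hsub with h | h
      · exact congrArg _ (Subtype.ext h)
      · exact absurd (Subtype.ext h.symm) hlt.ne

/-- The facets of the nestohedron of a connected building set correspond to its proper members. -/
noncomputable def facetEquiv (B : BuildingSet V) (hV : Finset.univ ∈ B.sets) :
    {S // S ∈ B.sets.erase Finset.univ} ≃ (nestohedron B).Facet :=
  Equiv.ofBijective (fun S => ⟨nestedFaceIso B hV (OrderDual.toDual (singletonNested B S)),
    (isCoatom_iff_exists B hV _).2 ⟨S, rfl⟩⟩) (by
    constructor
    · intro S S' h
      have := (nestedFaceIso B hV).injective (congrArg Subtype.val h)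
      exact Subtype.ext (Finset.singleton_injective (congrArg Subtype.val this))
    · rintro ⟨F, hF⟩
      obtain ⟨S, hS⟩ := (isCoatom_iff_exists B hV F).1 hF
      exact ⟨S, Subtype.ext hS⟩)

theorem card_facets_through (B : BuildingSet V) (hV : Finset.univ ∈ B.sets) {v : V → ℝ}
    (hv : v ∈ (nestohedron B).carrier) :
    Nat.card {F : (nestohedron B).Facet // v ∈ F.1.1} = (active B v).card := by
  have h : ∀ S, S.1 ∈ active B v ↔ v ∈ (facetEquiv B hV S).1.1 := by
    intro S
    refine Iff.trans ?_ (mem_nestedFaceIso B hV _ v).symm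
    exact ⟨fun h => ⟨hv, Finset.singleton_subset_iff.2 h⟩,
      fun h => Finset.singleton_subset_iff.1 h.2⟩
  rw [← Nat.card_congr ((facetEquiv B hV).subtypeEquiv h), Nat.card_congr
    (Equiv.subtypeSubtypeEquivSubtype fun {S} hS => active_subset B v hS)]
  simp

/-- At a vertex the tight set is a single point, so every core is a single node. Sending a set to
the node of its core is a bijection from `N ∪ {univ}` to `V`. -/
theorem card_active_of_mem_extremePoints (B : BuildingSet V) (hV : Finset.univ ∈ B.sets)
    {v : V → ℝ} (hv : v ∈ (nestohedron B).carrier.extremePoints ℝ) :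
    (active B v).card + 1 = Fintype.card V := by
  have hvP : v ∈ (nestohedron B).carrier := hv.1
  have hface : (nestohedron B).IsFace {v} :=
    ⟨Set.singleton_nonempty v, convex_singleton v, isExtreme_singleton.2 hv⟩
  have htight := tightSet_subset_of_isFace B hface rfl
  set N := active B v with hN
  have hNe : N ⊆ B.sets.erase Finset.univ := active_subset B v
  have hNB : N ⊆ B.sets := hNe.trans (Finset.erase_subset _ _)
  have hnest : IsNested B.sets N := isNested_active B hvP
  have hNB' : ∀ T ∈ insert Finset.univ N, T ∈ B.sets := by
    intro T hT
    rcases Finset.mem_insert.1 hT with rfl | h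
    · exact hV
    · exact hNB h
  have hVne : Nonempty V := (B.nonempty_of_mem _ hV).to_type
  have hc : ∀ T : Finset V, ∃ i, T ∈ B.sets → i ∈ core N T := by
    intro T
    by_cases hT : T ∈ B.sets
    · obtain ⟨i, hi⟩ := core_nonempty B hNB hnest hT
      exact ⟨i, fun _ => hi⟩
    · exact ⟨hVne.some, fun h => absurd h hT⟩
  choose c hc using hc
  -- Two nodes in the core of `T` would give two different points of the tight set.
  have huniq : ∀ T ∈ B.sets, ∀ j ∈ core N T, j = c T := by
    intro T hT j hj
    have h1 : ∑ U ∈ B.sets, (Pi.single (c U) 1 : V → ℝ) = v :=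
      htight (sum_mem_tightSet B fun U hU => single_mem_stdFace (hc U hU))
    have h2 : ∑ U ∈ B.sets, (Pi.single (Function.update c T j U) 1 : V → ℝ) = v :=
      htight (sum_mem_tightSet B fun U hU => single_mem_stdFace (by
        by_cases h : U = T
        · subst h; rwa [Function.update_self]
        · rw [Function.update_of_ne h]; exact hc U hU))
    have h3 := sum_single_update B (c := c) hT j
    rw [h1, h2, sub_self] at h3
    by_contra hne
    have := congrFun h3 j
    simp [hne] at this
  have hinj : Set.InjOn c (insert Finset.univ N : Finset (Finset V)) := by
    have hle : ∀ T ∈ insert Finset.univ N, ∀ T' ∈ insert Finset.univ N, c T = c T' → T ⊆ T' := by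
      intro T hT T' hT' h
      rcases Finset.mem_insert.1 hT' with rfl | hT''
      · exact Finset.subset_univ _
      · exact (mem_core.1 (hc T (hNB' T hT))).2 T' hT''
          (h ▸ core_subset N T' (hc T' (hNB' T' hT')))
    exact fun T hT T' hT' h => (hle T hT T' hT' h).antisymm (hle T' hT' T hT h.symm)
  -- Each node lies in the core of the least set of `N ∪ {univ}` that contains it.
  have hsurj : (insert Finset.univ N).image c = Finset.univ := by
    refine Finset.eq_univ_of_forall fun i => ?_
    obtain ⟨T, hT, hiT, hmin⟩ :=
      exists_minimal_mem_insert_univ B hNB hnest (Finset.singleton_nonempty i)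
    refine Finset.mem_image.2 ⟨T, hT, (huniq T (hNB' T hT) i (mem_core.2
      ⟨Finset.singleton_subset_iff.1 hiT, fun S hS hi =>
        hmin S hS (Finset.singleton_subset_iff.2 hi)⟩)).symm⟩
  rw [← Finset.card_univ, ← hsurj, Finset.card_image_of_injOn hinj,
    Finset.card_insert_of_notMem fun h => (Finset.mem_erase.1 (hNe h)).1 rfl]

/-- The direction space is that of the full standard simplex. Each summand lies in that simplex;
conversely the simplex is itself a summand because `univ` is a member, and moving its vertex from
`i` to `j` realizes `e_j - e_i`. -/
theorem dim_nestohedron (B : BuildingSet V) (hV : Finset.univ ∈ B.sets) :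
    (nestohedron B).dim + 1 = Fintype.card V := by
  have hVne : Nonempty V := (B.nonempty_of_mem _ hV).to_type
  set e : V → V → ℝ := fun i => Pi.single i 1 with he
  have hspan : vectorSpan ℝ (show Set (V → ℝ) from (nestohedron B).carrier) =
      vectorSpan ℝ (Set.range e) := by
    apply le_antisymm
    · rw [vectorSpan_def, Submodule.span_le]
      rintro _ ⟨x, hx, x', hx', rfl⟩
      obtain ⟨y, hy, rfl⟩ := mem_nestohedron.1 hx
      obtain ⟨y', hy', rfl⟩ := mem_nestohedron.1 hx'
      change ∑ T ∈ B.sets, y T - ∑ T ∈ B.sets, y' T ∈ _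
      rw [← Finset.sum_sub_distrib]
      refine Submodule.sum_mem _ fun T hT => ?_
      have hsub : stdFace T ⊆ convexHull ℝ (Set.range e) :=
        convexHull_mono (Set.image_subset_range _ _)
      rw [← direction_affineSpan, ← affineSpan_convexHull, direction_affineSpan]
      exact vsub_mem_vectorSpan ℝ (hsub (hy T hT)) (hsub (hy' T hT))
    · rw [vectorSpan_def, Submodule.span_le]
      rintro _ ⟨_, ⟨j, rfl⟩, _, ⟨i, rfl⟩, rfl⟩
      have hc : ∀ T : Finset V, ∃ k, (T ∈ B.sets → k ∈ T) ∧ (T = Finset.univ → k = i) := by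
        intro T
        by_cases hT : T = Finset.univ
        · exact ⟨i, fun _ => hT ▸ Finset.mem_univ i, fun _ => rfl⟩
        by_cases hTB : T ∈ B.sets
        · obtain ⟨k, hk⟩ := B.nonempty_of_mem T hTB
          exact ⟨k, fun _ => hk, fun h => absurd h hT⟩
        · exact ⟨i, fun h => absurd h hTB, fun _ => rfl⟩
      choose c hc hci using hc
      have h1 := sum_single_update B (c := c) hV j
      rw [hci _ rfl] at h1
      change (Pi.single j 1 - Pi.single i 1 : V → ℝ) ∈ _
      rw [← h1]
      refine vsub_mem_vectorSpan ℝ (sum_single_mem_nestohedron B fun T hT => ?_)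
        (sum_single_mem_nestohedron B fun T hT => hc T hT)
      by_cases h : T = Finset.univ
      · subst h; exact Finset.mem_univ _
      · rw [Function.update_of_ne h]; exact hc T hT
  have hind : AffineIndependent ℝ e :=
    (Pi.linearIndependent_single_one V ℝ).affineIndependent
  have hpos : 0 < Fintype.card V := Fintype.card_pos
  have := hind.finrank_vectorSpan (n := Fintype.card V - 1) (by omega)
  rw [← hspan] at this
  have h2 : (nestohedron B).dim = Fintype.card V - 1 := this
  omega

/-- The nestohedron of a connected building set is simple. -/
theorem isSimple_nestohedron (B : BuildingSet V) (hV : Finset.univ ∈ B.sets) :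
    (nestohedron B).IsSimple := by
  intro v hv
  have h1 := card_active_of_mem_extremePoints B hV hv
  have h2 := dim_nestohedron B hV
  exact (card_facets_through B hV hv.1).trans (by omega)

end

section

variable {V W W' : Type} [DecidableEq V] [Fintype W] [DecidableEq W] [Fintype W']
  [DecidableEq W']

/-! ### The boundary of a nestohedron -/

theorem cls_eq_of_orderIso {P Q : Polytope} (h : Nonempty (P.Face ≃o Q.Face)) : cls P = cls Q :=
  congrArg (fun c => MonoidAlgebra.single c (1 : ℚ)) (Quotient.sound h)

theorem cls_prod (P Q : Polytope) : cls (P.prod Q) = cls P * cls Q := by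
  rw [cls, cls, cls, MonoidAlgebra.single_mul_single, one_mul]
  rfl

theorem boundary_cls (P : Polytope) : boundary (cls P) = facetSum P := by
  simp only [boundary, cls, LinearMap.comp_apply]
  exact (Finsupp.linearCombination_single ℚ (1 : ℚ) _).trans (one_smul _ _)

theorem restriction_eq_map (B : BuildingSet V) (B₁ : BuildingSet W) (f : W ↪ V)
    (h : ∀ T, T ∈ B₁.sets ↔ T.map f ∈ B.sets) :
    restriction B.sets (Finset.univ.map f) =
      B₁.sets.map (Finset.mapEmbedding f).toEmbedding := by
  ext T
  rw [mem_restriction, Finset.mem_map]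
  constructor
  · rintro ⟨hT, hTS⟩
    obtain ⟨U, -, rfl⟩ := Finset.subset_map_iff.1 hTS
    exact ⟨U, (h U).2 hT, rfl⟩
  · rintro ⟨U, hU, rfl⟩
    exact ⟨(h U).1 hU, Finset.map_subset_map.2 (Finset.subset_univ U)⟩

variable [Fintype V]

theorem facetSum_nestohedron (B : BuildingSet V) (hV : Finset.univ ∈ B.sets) :
    facetSum (nestohedron B) =
      ∑ S : {S // S ∈ B.sets.erase Finset.univ},
        cls ((nestohedron B).ofFace (facetEquiv B hV S).1) :=
  ((facetEquiv B hV).sum_comp fun F => cls ((nestohedron B).ofFace F.1)).symm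

theorem contraction_eq_map (B : BuildingSet V) (B₂ : BuildingSet W) (f : W ↪ V) {S : Finset V}
    (hf : Finset.univ.map f = Sᶜ)
    (h : ∀ T : Finset W, T.Nonempty → (T ∈ B₂.sets ↔ T.map f ∈ B.sets ∨ T.map f ∪ S ∈ B.sets)) :
    contraction B.sets S = B₂.sets.map (Finset.mapEmbedding f).toEmbedding := by
  ext T
  rw [mem_contraction, Finset.mem_map, ← Finset.subset_compl_iff_disjoint_right, ← hf]
  constructor
  · rintro ⟨hTS, hne, hT⟩
    obtain ⟨U, -, rfl⟩ := Finset.subset_map_iff.1 hTS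
    exact ⟨U, (h U (Finset.map_nonempty.1 hne)).2 hT, rfl⟩
  · rintro ⟨U, hU, rfl⟩
    have hne := B₂.nonempty_of_mem U hU
    exact ⟨Finset.map_subset_map.2 (Finset.subset_univ U), Finset.map_nonempty.2 hne,
      (h U hne).1 hU⟩

/-- A facet of a nestohedron is the product of the nestohedra of the restriction and of the
contraction. -/
theorem cls_facet (B : BuildingSet V) (hV : Finset.univ ∈ B.sets)
    (S : {S // S ∈ B.sets.erase Finset.univ}) (B₁ : BuildingSet W) (B₂ : BuildingSet W')
    (f₁ : W ↪ V) (f₂ : W' ↪ V) (hf₁ : Finset.univ.map f₁ = S.1)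
    (hf₂ : Finset.univ.map f₂ = S.1ᶜ)
    (h₁ : ∀ T, T ∈ B₁.sets ↔ T.map f₁ ∈ B.sets)
    (h₂ : ∀ T : Finset W', T.Nonempty →
      (T ∈ B₂.sets ↔ T.map f₂ ∈ B.sets ∨ T.map f₂ ∪ S.1 ∈ B.sets)) :
    cls ((nestohedron B).ofFace (facetEquiv B hV S).1) =
      cls (nestohedron B₁) * cls (nestohedron B₂) := by
  obtain ⟨S, hS⟩ := S
  dsimp only at hf₁ hf₂ h₂
  subst hf₁
  obtain ⟨hSV, hSB⟩ := Finset.mem_erase.1 hS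
  have hV₁ : Finset.univ ∈ B₁.sets := (h₁ _).2 hSB
  have hV₂ : Finset.univ ∈ B₂.sets := by
    have hne : (Finset.univ : Finset W').Nonempty := by
      rw [← Finset.map_nonempty (f := f₂), hf₂, Finset.nonempty_iff_ne_empty, Ne,
        Finset.compl_eq_empty_iff]
      exact hSV
    refine (h₂ _ hne).2 (Or.inr ?_)
    rwa [hf₂, Finset.union_comm, Finset.union_compl]
  rw [← cls_prod]
  apply cls_eq_of_orderIso
  obtain ⟨e⟩ := nestedSets_link B hV hSB hSV
  rw [contraction_eq_map B B₂ f₂ hf₂ h₂, restriction_eq_map B B₁ f₁ h₁, ← hf₂] at e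
  obtain ⟨e₁⟩ := nestedSets_map f₁ B₁.sets Finset.univ
  obtain ⟨e₂⟩ := nestedSets_map f₂ B₂.sets Finset.univ
  let e' := (prodCongrIso e₁ e₂).trans e
  let g := nestedFaceIso B hV
  -- Faces below the facet of `S` correspond to nested sets containing `S`; the duals record that
  -- inclusion of faces reverses inclusion of nested sets.
  let k : Set.Iic (facetEquiv B hV ⟨Finset.univ.map f₁, hS⟩).1 ≃o
      {N : NestedSets B.sets Finset.univ // Finset.univ.map f₁ ∈ N.1}ᵒᵈ :=
    { toFun := fun F => OrderDual.toDual ⟨OrderDual.ofDual (g.symm F.1), by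
        have h : g.symm F.1 ≤ OrderDual.toDual (singletonNested B ⟨_, hS⟩) :=
          (OrderIso.symm_apply_le g).2 F.2
        exact Finset.singleton_subset_iff.1 h⟩
      invFun := fun N => ⟨g (OrderDual.toDual (OrderDual.ofDual N).1),
        g.le_iff_le.2 (Finset.singleton_subset_iff.2 (OrderDual.ofDual N).2)⟩
      left_inv := fun F => Subtype.ext (g.apply_symm_apply F.1)
      right_inv := fun N => Subtype.ext (g.symm_apply_apply (OrderDual.toDual (OrderDual.ofDual N).1))
      map_rel_iff' := fun {F F'} => g.symm.le_iff_le (x := F.1) (y := F'.1) }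
  let p : (NestedSets B₁.sets Finset.univ × NestedSets B₂.sets Finset.univ)ᵒᵈ ≃o
      (NestedSets B₁.sets Finset.univ)ᵒᵈ × (NestedSets B₂.sets Finset.univ)ᵒᵈ :=
    { toEquiv := Equiv.refl _, map_rel_iff' := Iff.rfl }
  exact ⟨((nestohedron B).ofFaceOrderIso _).trans (k.trans (e'.symm.dual.trans (p.trans
    ((prodCongrIso (nestedFaceIso B₁ hV₁) (nestedFaceIso B₂ hV₂)).trans
      (prodFaceIso _ _).symm))))⟩

theorem erase_univ_eq_empty (B : BuildingSet V) [Subsingleton V] :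
    B.sets.erase Finset.univ = ∅ := by
  refine Finset.eq_empty_of_forall_notMem fun T hT => ?_
  obtain ⟨h1, h2⟩ := Finset.mem_erase.1 hT
  obtain ⟨i, hi⟩ := B.nonempty_of_mem T h2
  exact h1 (Finset.eq_univ_of_forall fun j => Subsingleton.elim i j ▸ hi)

theorem univ_mem_of_unique (B : BuildingSet V) [Subsingleton V] [Nonempty V] :
    Finset.univ ∈ B.sets := by
  have h := B.singleton_mem (Classical.arbitrary V)
  rwa [Finset.eq_univ_of_forall fun j : V =>
    Finset.mem_singleton.2 (Subsingleton.elim j (Classical.arbitrary V))] at h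

theorem cls_nestohedron_of_subsingleton (B : BuildingSet V) [Subsingleton V] [Nonempty V] :
    cls (nestohedron B) = 1 := by
  have h : ∀ N : NestedSets B.sets Finset.univ, N.1 = ∅ := fun N =>
    Finset.subset_empty.1 (erase_univ_eq_empty B ▸ N.2.1)
  have hs : Subsingleton (nestohedron B).Face := by
    refine ⟨fun F G => ?_⟩
    obtain ⟨N, rfl⟩ := (nestedFaceIso B (univ_mem_of_unique B)).surjective F
    obtain ⟨M, rfl⟩ := (nestedFaceIso B (univ_mem_of_unique B)).surjective G
    exact congrArg _ (Subtype.ext ((h N).trans (h M).symm))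
  let u : Unique (nestohedron B).Face := ⟨⟨⊤⟩, fun _ => Subsingleton.elim _ _⟩
  exact cls_eq_of_orderIso (Q := point) ⟨OrderIso.ofUnique _ _⟩

theorem facetSum_nestohedron_of_subsingleton (B : BuildingSet V) [Subsingleton V] [Nonempty V] :
    facetSum (nestohedron B) = 0 := by
  rw [facetSum_nestohedron B (univ_mem_of_unique B)]
  have : IsEmpty {S // S ∈ B.sets.erase Finset.univ} := by
    rw [erase_univ_eq_empty]
    exact ⟨fun S => Finset.notMem_empty _ S.2⟩
  exact Fintype.sum_empty _

theorem cls_nestohedron_mem (B : BuildingSet V) (hV : Finset.univ ∈ B.sets) :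
    cls (nestohedron B) ∈ simplePolytopeRing :=
  Algebra.subset_adjoin ⟨_, isSimple_nestohedron B hV, rfl⟩

/-! ### The graphical building sets of the families -/

theorem join_adj_inl_inl {α β : Type} {G : SimpleGraph α} {H : SimpleGraph β} {a b : α} :
    (join G H).Adj (.inl a) (.inl b) ↔ G.Adj a b := by simp [join]

theorem join_adj_inr_inr {α β : Type} {G : SimpleGraph α} {H : SimpleGraph β} {a b : β} :
    (join G H).Adj (.inr a) (.inr b) ↔ H.Adj a b := by simp [join]

theorem join_adj_inl_inr {α β : Type} {G : SimpleGraph α} {H : SimpleGraph β} {a : α} {b : β} :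
    (join G H).Adj (.inl a) (.inr b) := by simp [join]

theorem join_adj_inr_inl {α β : Type} {G : SimpleGraph α} {H : SimpleGraph β} {a : α} {b : β} :
    (join G H).Adj (.inr b) (.inl a) := by simp [join]

theorem mem_graphicalBuildingSet {G : SimpleGraph V} {S : Finset V} :
    S ∈ (graphicalBuildingSet G).sets ↔ S.Nonempty ∧ (G.induce (S : Set V)).Connected := by
  simp [graphicalBuildingSet]

theorem univ_mem_graphicalBuildingSet_iff {G : SimpleGraph V} :
    Finset.univ ∈ (graphicalBuildingSet G).sets ↔ G.Connected := by
  rw [mem_graphicalBuildingSet, Finset.coe_univ, (SimpleGraph.induceUnivIso G).connected_iff]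
  refine and_iff_right_of_imp fun h => ?_
  have := h.nonempty
  exact Finset.univ_nonempty

theorem card_eq_one_or_exists_adj_of_mem {G : SimpleGraph V} {S : Finset V}
    (hS : S ∈ (graphicalBuildingSet G).sets) :
    S.card = 1 ∨ ∃ v ∈ S, ∃ w ∈ S, G.Adj v w := by
  obtain ⟨hne, hS⟩ := mem_graphicalBuildingSet.1 hS
  refine or_iff_not_imp_left.2 fun hcard => ?_
  have h1 : 1 < S.card := by have := hne.card_pos; omega
  obtain ⟨v, hv, w, hw, hvw⟩ := Finset.one_lt_card.1 h1
  obtain ⟨p⟩ := hS.preconnected ⟨v, hv⟩ ⟨w, hw⟩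
  cases p with
  | nil => exact absurd rfl hvw
  | cons h _ => exact ⟨v, hv, _, Subtype.prop _, h⟩

theorem mem_graphicalBuildingSet_of_card_eq_one (G : SimpleGraph V) {S : Finset V}
    (hS : S.card = 1) : S ∈ (graphicalBuildingSet G).sets := by
  obtain ⟨v, rfl⟩ := Finset.card_eq_one.1 hS
  exact (graphicalBuildingSet G).singleton_mem v

/-- Paths of length at most two from one node suffice for all the graphs considered here. -/
theorem mem_graphicalBuildingSet_of_center {G : SimpleGraph V} {S : Finset V} {c : V} (hc : c ∈ S)
    (h : ∀ v ∈ S, v = c ∨ G.Adj c v ∨ ∃ w ∈ S, G.Adj c w ∧ G.Adj w v) :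
    S ∈ (graphicalBuildingSet G).sets := by
  refine mem_graphicalBuildingSet.2 ⟨⟨c, hc⟩, ?_⟩
  rw [SimpleGraph.connected_iff_exists_forall_reachable]
  refine ⟨⟨c, hc⟩, ?_⟩
  rintro ⟨v, hv⟩
  rcases h v hv with rfl | h | ⟨w, hw, h1, h2⟩
  · exact SimpleGraph.Reachable.refl _
  · exact SimpleGraph.Adj.reachable h
  · have h1' : (G.induce (S : Set V)).Adj ⟨c, hc⟩ ⟨w, hw⟩ := h1
    have h2' : (G.induce (S : Set V)).Adj ⟨w, hw⟩ ⟨v, hv⟩ := h2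
    exact h1'.reachable.trans h2'.reachable

theorem mem_graphicalBuildingSet_top {S : Finset V} :
    S ∈ (graphicalBuildingSet (⊤ : SimpleGraph V)).sets ↔ S.Nonempty := by
  refine ⟨fun h => (mem_graphicalBuildingSet.1 h).1, ?_⟩
  rintro ⟨c, hc⟩
  refine mem_graphicalBuildingSet_of_center hc fun v _ => ?_
  by_cases h : v = c
  · exact Or.inl h
  · exact Or.inr (Or.inl (Ne.symm h))

/-- A connected set with more than one node contains an edge, and edges run only between the parts.
Conversely, a left node reaches its own part through any right node. -/
theorem mem_graphicalBuildingSet_bot_join_bot {S : Finset (V ⊕ W)} :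
    S ∈ (graphicalBuildingSet (join (⊥ : SimpleGraph V) (⊥ : SimpleGraph W))).sets ↔
      S.card = 1 ∨ (∃ a, .inl a ∈ S) ∧ ∃ b, .inr b ∈ S := by
  constructor
  · intro h
    refine (card_eq_one_or_exists_adj_of_mem h).imp_right ?_
    rintro ⟨v | v, hv, w | w, hw, h⟩
    · exact absurd (join_adj_inl_inl.1 h) (by simp)
    · exact ⟨⟨_, hv⟩, _, hw⟩
    · exact ⟨⟨_, hw⟩, _, hv⟩
    · exact absurd (join_adj_inr_inr.1 h) (by simp)
  · rintro (h | ⟨⟨a, ha⟩, b, hb⟩)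
    · exact mem_graphicalBuildingSet_of_card_eq_one _ h
    refine mem_graphicalBuildingSet_of_center ha ?_
    rintro (v | v) hv
    · exact Or.inr (Or.inr ⟨_, hb, join_adj_inl_inr, join_adj_inr_inl⟩)
    · exact Or.inr (Or.inl join_adj_inl_inr)

theorem mem_graphicalBuildingSet_top_join_bot {S : Finset (V ⊕ W)} :
    S ∈ (graphicalBuildingSet (join (⊤ : SimpleGraph V) (⊥ : SimpleGraph W))).sets ↔
      S.card = 1 ∨ ∃ a, .inl a ∈ S := by
  constructor
  · intro h
    refine (card_eq_one_or_exists_adj_of_mem h).imp_right ?_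
    rintro ⟨v | v, hv, w | w, hw, h⟩
    · exact ⟨_, hv⟩
    · exact ⟨_, hv⟩
    · exact ⟨_, hw⟩
    · exact absurd (join_adj_inr_inr.1 h) (by simp)
  · rintro (h | ⟨a, ha⟩)
    · exact mem_graphicalBuildingSet_of_card_eq_one _ h
    refine mem_graphicalBuildingSet_of_center ha ?_
    rintro (v | v) hv
    · by_cases hva : v = a
      · exact Or.inl (hva ▸ rfl)
      · exact Or.inr (Or.inl (join_adj_inl_inl.2 (Ne.symm hva)))
    · exact Or.inr (Or.inl join_adj_inl_inr)

end

/-! ### The facets of the nestohedra of complete bipartite graphs -/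

theorem exists_embedding_map_univ {α : Type} {n : ℕ} (s : Finset α) (h : s.card = n) :
    ∃ f : Fin n ↪ α, Finset.univ.map f = s := by
  refine ⟨(s.equivFinOfCardEq h).symm.toEmbedding.trans (Function.Embedding.subtype _), ?_⟩
  ext x
  simp only [Finset.mem_map, Finset.mem_univ, true_and, Function.Embedding.trans_apply,
    Equiv.coe_toEmbedding, Function.Embedding.subtype_apply]
  exact ⟨fun ⟨i, hi⟩ => hi ▸ Subtype.prop _,
    fun hx => ⟨s.equivFinOfCardEq h ⟨x, hx⟩, by rw [Equiv.symm_apply_apply]⟩⟩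

/-- The class of the nestohedron of `K_{i,j}` if both parts are nonempty, and `0` otherwise. -/
noncomputable def bipartiteCls (i j : ℕ) : PolytopeRing :=
  if 1 ≤ i ∧ 1 ≤ j then graphCls (emptyJoinEmpty i j) else 0

/-- The class of the permutohedron on `n` nodes if `n` is positive, and `0` otherwise. -/
noncomputable def permutohedronCls (n : ℕ) : PolytopeRing :=
  if n = 0 then 0 else graphCls (⊤ : SimpleGraph (Fin n))

/-- The class of a facet of the nestohedron of `K_{k,l}` that belongs to a member of the building
set with `i` and `j` nodes in the two parts. -/
noncomputable def bipartiteFacetCls (k l i j : ℕ) : PolytopeRing :=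
  (if i = 1 ∧ j = 0 then graphCls (completeJoinEmpty l (k - 1)) else 0) +
    (if i = 0 ∧ j = 1 then graphCls (completeJoinEmpty k (l - 1)) else 0) +
    bipartiteCls i j * permutohedronCls ((k - i) + (l - j))

section

variable {k l : ℕ}

theorem univ_mem_emptyJoinEmpty (hk : 1 ≤ k) (hl : 1 ≤ l) :
    Finset.univ ∈ (graphicalBuildingSet (emptyJoinEmpty k l)).sets :=
  mem_graphicalBuildingSet_bot_join_bot.2
    (Or.inr ⟨⟨⟨0, hk⟩, Finset.mem_univ _⟩, ⟨0, hl⟩, Finset.mem_univ _⟩)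

/-- Since `S` meets both parts, so does `T ∪ S` for every `T`. Every nonempty set is therefore in
the contraction, which is the building set of a complete graph. -/
theorem cls_facet_of_both (hV : Finset.univ ∈ (graphicalBuildingSet (emptyJoinEmpty k l)).sets)
    (S : {S // S ∈ (graphicalBuildingSet (emptyJoinEmpty k l)).sets.erase Finset.univ})
    (h₁ : 1 ≤ S.1.toLeft.card) (h₂ : 1 ≤ S.1.toRight.card) :
    cls ((nestohedron (graphicalBuildingSet (emptyJoinEmpty k l))).ofFace (facetEquiv _ hV S).1) =
      bipartiteFacetCls k l S.1.toLeft.card S.1.toRight.card := by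
  obtain ⟨e₁, he₁⟩ := exists_embedding_map_univ S.1.toLeft rfl
  obtain ⟨e₂, he₂⟩ := exists_embedding_map_univ S.1.toRight rfl
  have hcardS := Finset.card_toLeft_add_card_toRight (u := S.1)
  have hk := Finset.card_le_univ S.1.toLeft
  have hl := Finset.card_le_univ S.1.toRight
  rw [Fintype.card_fin] at hk hl
  have hcard : S.1ᶜ.card = (k - S.1.toLeft.card) + (l - S.1.toRight.card) := by
    rw [Finset.card_compl, Fintype.card_sum, Fintype.card_fin, Fintype.card_fin]
    omega
  obtain ⟨f₂, hf₂⟩ := exists_embedding_map_univ S.1ᶜ hcard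
  have hne : (k - S.1.toLeft.card) + (l - S.1.toRight.card) ≠ 0 := by
    rw [← hcard, Ne, Finset.card_eq_zero, Finset.compl_eq_empty_iff]
    exact (Finset.mem_erase.1 S.2).1
  rw [cls_facet _ hV S (graphicalBuildingSet (emptyJoinEmpty S.1.toLeft.card S.1.toRight.card))
    (graphicalBuildingSet ⊤) (e₁.sumMap e₂) f₂ ?_ hf₂ ?_ ?_]
  · rw [bipartiteFacetCls, if_neg (by omega), if_neg (by omega), zero_add, zero_add, bipartiteCls,
      if_pos ⟨h₁, h₂⟩, permutohedronCls, if_neg hne]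
    rfl
  · ext x
    rcases x with x | x
    · refine Iff.trans ?_ ((Finset.ext_iff.1 he₁ x).trans Finset.mem_toLeft)
      simp
    · refine Iff.trans ?_ ((Finset.ext_iff.1 he₂ x).trans Finset.mem_toRight)
      simp
  · intro T
    rw [mem_graphicalBuildingSet_bot_join_bot, mem_graphicalBuildingSet_bot_join_bot,
      Finset.card_map]
    simp
  · intro T hT
    rw [mem_graphicalBuildingSet_top]
    refine iff_of_true hT (Or.inr (mem_graphicalBuildingSet_bot_join_bot.2 (Or.inr ?_)))
    obtain ⟨a, ha⟩ := Finset.card_pos.1 h₁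
    obtain ⟨b, hb⟩ := Finset.card_pos.1 h₂
    exact ⟨⟨a, Finset.mem_union_right _ (Finset.mem_toLeft.1 ha)⟩,
      b, Finset.mem_union_right _ (Finset.mem_toRight.1 hb)⟩

/-- With the left node `a` adjoined, any set with a right node meets both parts. The contraction
thus consists of the single nodes and the sets with a right node: the right part has become
complete. The restriction is a single node and contributes the factor `1`. -/
theorem cls_facet_of_inl (hV : Finset.univ ∈ (graphicalBuildingSet (emptyJoinEmpty k l)).sets)
    (S : {S // S ∈ (graphicalBuildingSet (emptyJoinEmpty k l)).sets.erase Finset.univ})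
    {a : Fin k} (hS : S.1 = {.inl a}) :
    cls ((nestohedron (graphicalBuildingSet (emptyJoinEmpty k l))).ofFace (facetEquiv _ hV S).1) =
      graphCls (completeJoinEmpty l (k - 1)) := by
  obtain ⟨e, he⟩ := exists_embedding_map_univ (n := k - 1) ({a}ᶜ : Finset (Fin k))
    (by rw [Finset.card_compl, Finset.card_singleton, Fintype.card_fin])
  have hea : ∀ i, e i ≠ a := fun i h => by
    have : e i ∈ ({a}ᶜ : Finset (Fin k)) := he ▸ Finset.mem_map_of_mem e (Finset.mem_univ i)
    exact Finset.mem_compl.1 this (Finset.mem_singleton.2 h)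
  rw [cls_facet _ hV S (graphicalBuildingSet (⊤ : SimpleGraph Unit))
    (graphicalBuildingSet (completeJoinEmpty l (k - 1)))
    ⟨fun _ => .inl a, fun _ _ _ => rfl⟩
    -- The complete part comes first in `completeJoinEmpty` but is the right part here, hence the
    -- swap.
    (((Function.Embedding.refl _).sumMap e).trans (Equiv.sumComm _ _).toEmbedding) ?_ ?_ ?_ ?_,
    cls_nestohedron_of_subsingleton, one_mul]
  · rfl
  · rw [hS]
    rfl
  · rw [hS]
    ext x
    rcases x with x | x
    · have := congrArg (x ∈ ·) he
      simp at this
      simp [this]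
    · simp
  · intro T
    rw [mem_graphicalBuildingSet_top, mem_graphicalBuildingSet_bot_join_bot, Finset.card_map]
    constructor
    · intro hT
      exact Or.inl (le_antisymm (Finset.card_le_one_of_subsingleton T) hT.card_pos)
    · rintro (h | ⟨⟨x, hx⟩, -⟩)
      · exact Finset.card_pos.1 (h ▸ Nat.one_pos)
      · exact Finset.map_nonempty.1 ⟨_, hx⟩
  · intro T hT
    rw [hS, mem_graphicalBuildingSet_top_join_bot, mem_graphicalBuildingSet_bot_join_bot,
      mem_graphicalBuildingSet_bot_join_bot, Finset.card_map, Finset.card_union_of_disjoint,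
      Finset.card_map, Finset.card_singleton]
    · have := hT.card_pos
      constructor
      · rintro (h | ⟨x, hx⟩)
        · exact Or.inl (Or.inl h)
        · exact Or.inr (Or.inr ⟨⟨a, by simp⟩, x, by simpa using hx⟩)
      · rintro ((h | ⟨-, b, hb⟩) | (h | ⟨-, b, hb⟩))
        · exact Or.inl h
        · exact Or.inr ⟨b, by simpa using hb⟩
        · omega
        · exact Or.inr ⟨b, by simpa using hb⟩
    · simp [hea]

theorem cls_facet_of_inr (hV : Finset.univ ∈ (graphicalBuildingSet (emptyJoinEmpty k l)).sets)
    (S : {S // S ∈ (graphicalBuildingSet (emptyJoinEmpty k l)).sets.erase Finset.univ})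
    {b : Fin l} (hS : S.1 = {.inr b}) :
    cls ((nestohedron (graphicalBuildingSet (emptyJoinEmpty k l))).ofFace (facetEquiv _ hV S).1) =
      graphCls (completeJoinEmpty k (l - 1)) := by
  obtain ⟨e, he⟩ := exists_embedding_map_univ (n := l - 1) ({b}ᶜ : Finset (Fin l))
    (by rw [Finset.card_compl, Finset.card_singleton, Fintype.card_fin])
  have heb : ∀ i, e i ≠ b := fun i h => by
    have : e i ∈ ({b}ᶜ : Finset (Fin l)) := he ▸ Finset.mem_map_of_mem e (Finset.mem_univ i)
    exact Finset.mem_compl.1 this (Finset.mem_singleton.2 h)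
  rw [cls_facet _ hV S (graphicalBuildingSet (⊤ : SimpleGraph Unit))
    (graphicalBuildingSet (completeJoinEmpty k (l - 1)))
    ⟨fun _ => .inr b, fun _ _ _ => rfl⟩ ((Function.Embedding.refl _).sumMap e) ?_ ?_ ?_ ?_,
    cls_nestohedron_of_subsingleton, one_mul]
  · rfl
  · rw [hS]
    rfl
  · rw [hS]
    ext x
    rcases x with x | x
    · simp
    · have := congrArg (x ∈ ·) he
      simp at this
      simp [this]
  · intro T
    rw [mem_graphicalBuildingSet_top, mem_graphicalBuildingSet_bot_join_bot, Finset.card_map]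
    constructor
    · intro hT
      exact Or.inl (le_antisymm (Finset.card_le_one_of_subsingleton T) hT.card_pos)
    · rintro (h | ⟨⟨x, hx⟩, -⟩)
      · exact Finset.card_pos.1 (h ▸ Nat.one_pos)
      · exact Finset.map_nonempty.1 ⟨_, hx⟩
  · intro T hT
    rw [hS, mem_graphicalBuildingSet_top_join_bot, mem_graphicalBuildingSet_bot_join_bot,
      mem_graphicalBuildingSet_bot_join_bot, Finset.card_map, Finset.card_union_of_disjoint,
      Finset.card_map, Finset.card_singleton]
    · have := hT.card_pos
      constructor
      · rintro (h | ⟨x, hx⟩)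
        · exact Or.inl (Or.inl h)
        · exact Or.inr (Or.inr ⟨⟨x, by simpa using hx⟩, b, by simp⟩)
      · rintro ((h | ⟨⟨a, ha⟩, -⟩) | (h | ⟨⟨a, ha⟩, -⟩))
        · exact Or.inl h
        · exact Or.inr ⟨a, by simpa using ha⟩
        · omega
        · exact Or.inr ⟨a, by simpa using ha⟩
    · simp [heb]

theorem cls_facet_emptyJoinEmpty
    (hV : Finset.univ ∈ (graphicalBuildingSet (emptyJoinEmpty k l)).sets)
    (S : {S // S ∈ (graphicalBuildingSet (emptyJoinEmpty k l)).sets.erase Finset.univ}) :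
    cls ((nestohedron (graphicalBuildingSet (emptyJoinEmpty k l))).ofFace (facetEquiv _ hV S).1) =
      bipartiteFacetCls k l S.1.toLeft.card S.1.toRight.card := by
  rcases mem_graphicalBuildingSet_bot_join_bot.1 (Finset.mem_of_mem_erase S.2) with h | ⟨ha, hb⟩
  · obtain ⟨a | b, hS⟩ := Finset.card_eq_one.1 h
    · have h1 : S.1.toLeft.card = 1 := by rw [hS]; rfl
      have h2 : S.1.toRight.card = 0 := by rw [hS]; rfl
      rw [cls_facet_of_inl hV S hS, h1, h2]
      simp [bipartiteFacetCls, bipartiteCls]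
    · have h1 : S.1.toLeft.card = 0 := by rw [hS]; rfl
      have h2 : S.1.toRight.card = 1 := by rw [hS]; rfl
      rw [cls_facet_of_inr hV S hS, h1, h2]
      simp [bipartiteFacetCls, bipartiteCls]
  · obtain ⟨a, ha⟩ := ha
    obtain ⟨b, hb⟩ := hb
    exact cls_facet_of_both hV S (Finset.card_pos.2 ⟨a, Finset.mem_toLeft.2 ha⟩)
      (Finset.card_pos.2 ⟨b, Finset.mem_toRight.2 hb⟩)

/-- The class of a facet depends only on the sizes of the two traces, so the sum is grouped by them.
-/
theorem facetSum_emptyJoinEmpty (hk : 1 ≤ k) (hl : 1 ≤ l) :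
    facetSum (nestohedron (graphicalBuildingSet (emptyJoinEmpty k l))) =
      ∑ i ∈ Finset.range (k + 1), ∑ j ∈ Finset.range (l + 1),
        k.choose i • l.choose j • bipartiteFacetCls k l i j := by
  have hV := univ_mem_emptyJoinEmpty hk hl
  rw [facetSum_nestohedron _ hV, Finset.sum_congr rfl fun S _ => cls_facet_emptyJoinEmpty hV S]
  rw [Finset.sum_coe_sort ((graphicalBuildingSet (emptyJoinEmpty k l)).sets.erase Finset.univ)
    fun S => bipartiteFacetCls k l S.toLeft.card S.toRight.card]
  -- The sum may run over all node sets: `bipartiteFacetCls` vanishes on non-members, and on the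
  -- whole node set because `permutohedronCls 0 = 0`.
  rw [Finset.sum_subset (Finset.subset_univ _)]
  · refine (Fintype.sum_equiv Finset.sumEquiv.toEquiv _
      (fun p : Finset (Fin k) × Finset (Fin l) => bipartiteFacetCls k l p.1.card p.2.card)
      fun _ => rfl).trans ?_
    rw [Fintype.sum_prod_type]
    simp only [← Finset.powerset_univ]
    rw [Finset.sum_powerset_apply_card
      (fun i => ∑ t ∈ (Finset.univ : Finset (Fin l)).powerset, bipartiteFacetCls k l i t.card)]
    rw [Finset.card_univ, Fintype.card_fin]
    refine Finset.sum_congr rfl fun i _ => ?_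
    rw [Finset.sum_powerset_apply_card, Finset.card_univ, Fintype.card_fin, Finset.smul_sum]
  · intro S _ hS
    have hcard := Finset.card_toLeft_add_card_toRight (u := S)
    by_cases hSV : S = Finset.univ
    · have h1 : S.toLeft.card = k := by
        rw [hSV, Finset.toLeft_univ, Finset.card_univ, Fintype.card_fin]
      have h2 : S.toRight.card = l := by
        rw [hSV, Finset.toRight_univ, Finset.card_univ, Fintype.card_fin]
      rw [h1, h2, bipartiteFacetCls, if_neg (by omega), if_neg (by omega)]
      simp [permutohedronCls]
    · have hSB := mt mem_graphicalBuildingSet_bot_join_bot.2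
        fun h => hS (Finset.mem_erase.2 ⟨hSV, h⟩)
      push Not at hSB
      rw [bipartiteFacetCls, if_neg (by omega), if_neg (by omega), bipartiteCls, if_neg]
      · simp
      · rintro ⟨h1, h2⟩
        obtain ⟨a, ha⟩ := Finset.card_pos.1 h1
        obtain ⟨b, hb⟩ := Finset.card_pos.1 h2
        exact hSB.2 ⟨a, Finset.mem_toLeft.1 ha⟩ b (Finset.mem_toRight.1 hb)

end

/-! ### Coefficients of the series -/

/-- The exponent of the monomial `x ^ k * y ^ l`. -/
noncomputable def bidegree (k l : ℕ) : Fin 2 →₀ ℕ := Finsupp.single 0 k + Finsupp.single 1 l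

@[simp] theorem bidegree_zero (k l : ℕ) : bidegree k l 0 = k := by simp [bidegree]

@[simp] theorem bidegree_one (k l : ℕ) : bidegree k l 1 = l := by simp [bidegree]

theorem eq_bidegree_iff {m : Fin 2 →₀ ℕ} {k l : ℕ} : m = bidegree k l ↔ m 0 = k ∧ m 1 = l := by
  constructor
  · rintro rfl
    simp
  · rintro ⟨rfl, rfl⟩
    ext i
    fin_cases i <;> simp

theorem coeff_varX_pow_mul_varY_pow (m : Fin 2 →₀ ℕ) (k l : ℕ) :
    MvPowerSeries.coeff m (varX ^ k * varY ^ l) = if m 0 = k ∧ m 1 = l then 1 else 0 := by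
  classical
  rw [varX, varY, MvPowerSeries.X_pow_eq, MvPowerSeries.X_pow_eq,
    MvPowerSeries.monomial_mul_monomial, one_mul, MvPowerSeries.coeff_monomial]
  exact if_congr eq_bidegree_iff rfl rfl

theorem coeff_evalAt_varX_varY (f : Series) (k l : ℕ) :
    MvPowerSeries.coeff (bidegree k l) (evalAt f varX varY) =
      MvPowerSeries.coeff (bidegree k l) f := by
  have ha : MvPowerSeries.HasSubst ![varX, varY] :=
    MvPowerSeries.hasSubst_of_constantCoeff_zero fun s => by fin_cases s <;> simp
  rw [evalAt, MvPowerSeries.coeff_subst ha, finsum_eq_single _ (bidegree k l)]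
  · rw [Finsupp.prod_fintype _ _ (by simp), Fin.prod_univ_two]
    simp [coeff_varX_pow_mul_varY_pow]
  · intro d hd
    rw [Finsupp.prod_fintype _ _ (by simp), Fin.prod_univ_two]
    have h : ¬ (k = d 0 ∧ l = d 1) := fun h => hd (eq_bidegree_iff.2 ⟨h.1.symm, h.2.symm⟩)
    simp [coeff_varX_pow_mul_varY_pow, h]

theorem coeff_evalAt_varY_varX (f : Series) (k l : ℕ) :
    MvPowerSeries.coeff (bidegree k l) (evalAt f varY varX) =
      MvPowerSeries.coeff (bidegree l k) f := by
  have ha : MvPowerSeries.HasSubst ![varY, varX] :=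
    MvPowerSeries.hasSubst_of_constantCoeff_zero fun s => by fin_cases s <;> simp
  rw [evalAt, MvPowerSeries.coeff_subst ha, finsum_eq_single _ (bidegree l k)]
  · rw [Finsupp.prod_fintype _ _ (by simp), Fin.prod_univ_two, mul_comm]
    simp [coeff_varX_pow_mul_varY_pow]
  · intro d hd
    rw [Finsupp.prod_fintype _ _ (by simp), Fin.prod_univ_two, mul_comm]
    have h : ¬ (k = d 1 ∧ l = d 0) := fun h => hd (eq_bidegree_iff.2 ⟨h.2.symm, h.1.symm⟩)
    simp [coeff_varX_pow_mul_varY_pow, h]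

theorem coeff_add_pow (k l n : ℕ) :
    MvPowerSeries.coeff (bidegree k l) ((varX + varY) ^ n) =
      if n = k + l then ((n.choose k : ℕ) : PolytopeRing) else 0 := by
  rw [add_pow, map_sum]
  have h : ∀ i, MvPowerSeries.coeff (bidegree k l)
      (varX ^ i * varY ^ (n - i) * ((n.choose i : ℕ) : Series)) =
      if k = i ∧ l = n - i then ((n.choose i : ℕ) : PolytopeRing) else 0 := by
    intro i
    rw [← map_natCast (MvPowerSeries.C (σ := Fin 2) (R := PolytopeRing)),
      MvPowerSeries.coeff_mul_C, coeff_varX_pow_mul_varY_pow]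
    simp
  simp only [h]
  split_ifs with hn
  · rw [Finset.sum_eq_single k]
    · rw [if_pos ⟨rfl, by omega⟩]
    · intro i _ hi
      rw [if_neg fun h => hi h.1.symm]
    · intro hk
      exact absurd (Finset.mem_range.2 (by omega)) hk
  · refine Finset.sum_eq_zero fun i hi => if_neg ?_
    have := Finset.mem_range.1 hi
    omega

theorem coeff_seriesPe (n : ℕ) :
    PowerSeries.coeff n seriesPe = (n ! : ℚ)⁻¹ • permutohedronCls n := by
  rw [seriesPe, PowerSeries.coeff_mk]
  cases n with
  | zero => simp [permutohedronCls]
  | succ n => simp [permutohedronCls]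

/-- Only the power `(x+y)^(k+l)` contributes, and `(k+l).choose k / (k+l)! = 1 / (k! l!)`. -/
theorem coeff_subst_seriesPe (k l : ℕ) :
    MvPowerSeries.coeff (bidegree k l) (PowerSeries.subst (varX + varY) seriesPe) =
      (k ! * l ! : ℚ)⁻¹ • permutohedronCls (k + l) := by
  have ha : PowerSeries.HasSubst (varX + varY) :=
    PowerSeries.HasSubst.of_constantCoeff_zero (by simp)
  rw [PowerSeries.coeff_subst ha, finsum_eq_single _ (k + l)]
  · rw [coeff_add_pow, if_pos rfl, coeff_seriesPe, smul_eq_mul, smul_mul_assoc, mul_comm,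
      ← nsmul_eq_mul, ← Nat.cast_smul_eq_nsmul ℚ, smul_smul]
    congr 1
    have h1 : ((k + l) ! : ℚ) ≠ 0 := Nat.cast_ne_zero.2 (Nat.factorial_ne_zero _)
    have h2 : (k ! : ℚ) ≠ 0 := Nat.cast_ne_zero.2 (Nat.factorial_ne_zero _)
    have h3 : (l ! : ℚ) ≠ 0 := Nat.cast_ne_zero.2 (Nat.factorial_ne_zero _)
    have h4 : (((k + l).choose k * k ! * l ! : ℕ) : ℚ) = (k + l) ! := by
      rw [Nat.choose_symm_add, Nat.add_choose_mul_factorial_mul_factorial]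
    push_cast at h4
    field_simp
    linarith
  · intro n hn
    rw [coeff_add_pow, if_neg hn, smul_zero]

theorem coeff_seriesCE (k l : ℕ) :
    MvPowerSeries.coeff (bidegree k l) seriesCE =
      if 1 ≤ k then (k ! * l ! : ℚ)⁻¹ • graphCls (completeJoinEmpty k l) else 0 := by
  change seriesCE (bidegree k l) = _
  have h0 := bidegree_zero k l
  have h1 := bidegree_one k l
  unfold seriesCE
  -- The exponents occur in the type of the nodes, so they are generalized and substituted rather
  -- than rewritten.
  generalize bidegree k l 0 = a at h0 ⊢
  generalize bidegree k l 1 = b at h1 ⊢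
  subst h0 h1
  rfl

theorem emptyJoinEmpty_connected_iff (k l : ℕ) :
    (emptyJoinEmpty k l).Connected ↔ k + l = 1 ∨ 1 ≤ k ∧ 1 ≤ l := by
  rw [← univ_mem_graphicalBuildingSet_iff, mem_graphicalBuildingSet_bot_join_bot,
    Finset.card_univ, Fintype.card_sum, Fintype.card_fin, Fintype.card_fin]
  refine or_congr_right (and_congr ?_ ?_)
  · exact ⟨fun ⟨a, _⟩ => a.pos, fun h => ⟨⟨0, h⟩, Finset.mem_univ _⟩⟩
  · exact ⟨fun ⟨a, _⟩ => a.pos, fun h => ⟨⟨0, h⟩, Finset.mem_univ _⟩⟩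

theorem coeff_seriesEE (k l : ℕ) :
    MvPowerSeries.coeff (bidegree k l) seriesEE =
      if k + l = 1 ∨ 1 ≤ k ∧ 1 ≤ l then (k ! * l ! : ℚ)⁻¹ • graphCls (emptyJoinEmpty k l)
      else 0 := by
  change seriesEE (bidegree k l) = _
  have h0 := bidegree_zero k l
  have h1 := bidegree_one k l
  unfold seriesEE
  generalize bidegree k l 0 = a at h0 ⊢
  generalize bidegree k l 1 = b at h1 ⊢
  subst h0 h1
  classical exact if_congr (emptyJoinEmpty_connected_iff _ _) rfl rfl

theorem subsingleton_and_nonempty {k l : ℕ} (h : k + l = 1) :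
    Subsingleton (Fin k ⊕ Fin l) ∧ Nonempty (Fin k ⊕ Fin l) := by
  have hc : Fintype.card (Fin k ⊕ Fin l) = 1 := by simpa using h
  exact ⟨Fintype.card_le_one_iff_subsingleton.1 hc.le,
    Fintype.card_pos_iff.1 (hc ▸ Nat.one_pos)⟩

/-- The one-node graphs `K_{1,0}` and `K_{0,1}` have the point as nestohedron, so subtracting `x +
y` removes exactly their terms. This is the origin of the last term of the formula. -/
theorem coeff_seriesEE_sub (k l : ℕ) :
    MvPowerSeries.coeff (bidegree k l) (seriesEE - (varX + varY)) =
      (k ! * l ! : ℚ)⁻¹ • bipartiteCls k l := by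
  have hX := coeff_add_pow k l 1
  rw [pow_one] at hX
  rw [map_sub, coeff_seriesEE, hX, bipartiteCls]
  by_cases h : k + l = 1
  · obtain ⟨h1, h2⟩ := subsingleton_and_nonempty h
    have h3 : graphCls (emptyJoinEmpty k l) = 1 := cls_nestohedron_of_subsingleton _
    rw [if_pos (Or.inl h), if_pos h.symm, if_neg (by omega), h3, smul_zero, sub_eq_zero]
    rcases (by omega : k = 0 ∧ l = 1 ∨ k = 1 ∧ l = 0) with ⟨rfl, rfl⟩ | ⟨rfl, rfl⟩ <;> simp
  · rw [if_neg (Ne.symm h), sub_zero]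
    by_cases h' : 1 ≤ k ∧ 1 ≤ l
    · rw [if_pos (Or.inr h'), if_pos h']
    · rw [if_neg (by tauto), if_neg h', smul_zero]

theorem coeff_mul_bidegree (f g : Series) (k l : ℕ) :
    MvPowerSeries.coeff (bidegree k l) (f * g) =
      ∑ i ∈ Finset.range (k + 1), ∑ j ∈ Finset.range (l + 1),
        MvPowerSeries.coeff (bidegree i j) f *
          MvPowerSeries.coeff (bidegree (k - i) (l - j)) g := by
  classical
  rw [MvPowerSeries.coeff_mul, ← Finset.sum_product']
  symm
  refine Finset.sum_bij' (fun p _ => (bidegree p.1 p.2, bidegree (k - p.1) (l - p.2)))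
    (fun q _ => (q.1 0, q.1 1)) ?_ ?_ ?_ ?_ ?_
  · rintro ⟨i, j⟩ h
    simp only [Finset.mem_product, Finset.mem_range] at h
    rw [Finset.HasAntidiagonal.mem_antidiagonal, eq_bidegree_iff]
    simp only [Finsupp.add_apply, bidegree_zero, bidegree_one]
    omega
  · rintro ⟨p, q⟩ h
    rw [Finset.HasAntidiagonal.mem_antidiagonal, eq_bidegree_iff] at h
    simp only [Finsupp.add_apply] at h
    simp only [Finset.mem_product, Finset.mem_range]
    omega
  · rintro ⟨i, j⟩ _
    simp
  · rintro ⟨p, q⟩ h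
    rw [Finset.HasAntidiagonal.mem_antidiagonal, eq_bidegree_iff] at h
    simp only [Finsupp.add_apply] at h
    refine Prod.ext (eq_bidegree_iff.2 ⟨rfl, rfl⟩).symm (Eq.symm (eq_bidegree_iff.2 ⟨?_, ?_⟩)) <;>
      dsimp only <;> omega
  · rintro ⟨i, j⟩ _
    rfl

theorem coeff_varX_mul (f : Series) (k l : ℕ) :
    MvPowerSeries.coeff (bidegree k l) (varX * f) =
      if 1 ≤ k then MvPowerSeries.coeff (bidegree (k - 1) l) f else 0 := by
  have h : ∀ i j, MvPowerSeries.coeff (bidegree i j) varX =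
      if i = 1 ∧ j = 0 then (1 : PolytopeRing) else 0 := fun i j => by
    have := coeff_varX_pow_mul_varY_pow (bidegree i j) 1 0
    simpa using this
  rw [coeff_mul_bidegree]
  simp only [h, ite_and, ite_mul, one_mul, zero_mul]
  simp [Finset.sum_ite_eq', Nat.succ_le_iff]

theorem coeff_varY_mul (f : Series) (k l : ℕ) :
    MvPowerSeries.coeff (bidegree k l) (varY * f) =
      if 1 ≤ l then MvPowerSeries.coeff (bidegree k (l - 1)) f else 0 := by
  have h : ∀ i j, MvPowerSeries.coeff (bidegree i j) varY =
      if i = 0 ∧ j = 1 then (1 : PolytopeRing) else 0 := fun i j => by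
    have := coeff_varX_pow_mul_varY_pow (bidegree i j) 0 1
    simpa using this
  rw [coeff_mul_bidegree]
  simp only [h, ite_and, ite_mul, one_mul, zero_mul]
  simp [Finset.sum_ite_eq', Nat.succ_le_iff]

/-! ### The functional equation, coefficient by coefficient. -/

theorem coeff_seriesBoundary_seriesEE (k l : ℕ) :
    MvPowerSeries.coeff (bidegree k l) (seriesBoundary seriesEE) =
      if 1 ≤ k ∧ 1 ≤ l then (k ! * l ! : ℚ)⁻¹ •
        ∑ i ∈ Finset.range (k + 1), ∑ j ∈ Finset.range (l + 1),
          k.choose i • l.choose j • bipartiteFacetCls k l i j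
      else 0 := by
  change boundary (MvPowerSeries.coeff (bidegree k l) seriesEE) = _
  rw [coeff_seriesEE]
  by_cases h : k + l = 1
  · obtain ⟨h1, h2⟩ := subsingleton_and_nonempty h
    rw [if_pos (Or.inl h), if_neg (by omega), map_smul, graphCls, boundary_cls,
      facetSum_nestohedron_of_subsingleton, smul_zero]
  by_cases h' : 1 ≤ k ∧ 1 ≤ l
  · rw [if_pos (Or.inr h'), if_pos h', map_smul, graphCls, boundary_cls,
      facetSum_emptyJoinEmpty h'.1 h'.2]
  · rw [if_neg (by tauto), if_neg h', map_zero]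

theorem inv_factorial_mul_choose {k i : ℕ} (h : i ≤ k) :
    (k ! : ℚ)⁻¹ * k.choose i = (i ! : ℚ)⁻¹ * ((k - i)! : ℚ)⁻¹ := by
  have h1 : (k ! : ℚ) ≠ 0 := Nat.cast_ne_zero.2 (Nat.factorial_ne_zero _)
  rw [Nat.cast_choose ℚ h, ← mul_div_assoc, inv_mul_cancel₀ h1, one_div, mul_inv]

/-- Dividing the binomial coefficients by `k! l!` leaves factorials of `i, j` times factorials of `k
- i, l - j`, as in a product of exponential series. The single nodes sit at `(i, j) = (1, 0)` and
`(0, 1)`, whence the lowered factorials. -/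
theorem sum_bipartiteFacetCls {k l : ℕ} (hk : 1 ≤ k) (hl : 1 ≤ l) :
    (k ! * l ! : ℚ)⁻¹ • ∑ i ∈ Finset.range (k + 1), ∑ j ∈ Finset.range (l + 1),
        k.choose i • l.choose j • bipartiteFacetCls k l i j =
      ((k - 1)! * l ! : ℚ)⁻¹ • graphCls (completeJoinEmpty l (k - 1)) +
      (k ! * (l - 1)! : ℚ)⁻¹ • graphCls (completeJoinEmpty k (l - 1)) +
      ∑ i ∈ Finset.range (k + 1), ∑ j ∈ Finset.range (l + 1),
        ((i ! * j ! : ℚ)⁻¹ • bipartiteCls i j) *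
          (((k - i)! * (l - j)! : ℚ)⁻¹ • permutohedronCls ((k - i) + (l - j))) := by
  have hterm : ∀ i ∈ Finset.range (k + 1), ∀ j ∈ Finset.range (l + 1),
      (k ! * l ! : ℚ)⁻¹ • k.choose i • l.choose j • bipartiteFacetCls k l i j =
        (if i = 1 then if j = 0 then
          ((k - 1)! * l ! : ℚ)⁻¹ • graphCls (completeJoinEmpty l (k - 1)) else 0 else 0) +
        (if i = 0 then if j = 1 then
          (k ! * (l - 1)! : ℚ)⁻¹ • graphCls (completeJoinEmpty k (l - 1)) else 0 else 0) +
        ((i ! * j ! : ℚ)⁻¹ • bipartiteCls i j) *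
          (((k - i)! * (l - j)! : ℚ)⁻¹ • permutohedronCls ((k - i) + (l - j))) := by
    intro i hi j hj
    have hi := Nat.lt_succ_iff.1 (Finset.mem_range.1 hi)
    have hj := Nat.lt_succ_iff.1 (Finset.mem_range.1 hj)
    have hcoef : (k ! * l ! : ℚ)⁻¹ * (k.choose i * l.choose j) =
        (i ! * j ! : ℚ)⁻¹ * ((k - i)! * (l - j)! : ℚ)⁻¹ := by
      rw [mul_inv, mul_mul_mul_comm, inv_factorial_mul_choose hi, inv_factorial_mul_choose hj,
        mul_inv, mul_inv]
      ring
    rw [← Nat.cast_smul_eq_nsmul ℚ, ← Nat.cast_smul_eq_nsmul ℚ, smul_smul, smul_smul, mul_assoc,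
      hcoef, bipartiteFacetCls, smul_add, smul_add, smul_mul_smul_comm]
    congr 2
    · split_ifs with h1 h2 h3 h4 h5
      · rw [h1.1, h1.2]; simp
      all_goals first | rfl | exact smul_zero _ | (exfalso; tauto)
    · split_ifs with h1 h2 h3 h4 h5
      · rw [h1.1, h1.2]; simp
      all_goals first | rfl | exact smul_zero _ | (exfalso; tauto)
  rw [Finset.smul_sum]
  simp only [Finset.smul_sum]
  rw [Finset.sum_congr rfl fun i hi => Finset.sum_congr rfl (hterm i hi)]
  simp only [Finset.sum_add_distrib]
  congr 2
  · rw [Finset.sum_eq_single_of_mem 1 (Finset.mem_range.2 (by omega)),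
      Finset.sum_eq_single_of_mem 0 (Finset.mem_range.2 (by omega))]
    · simp
    · intro j _ hj; simp [hj]
    · intro i _ hi; simp [hi]
  · rw [Finset.sum_eq_single_of_mem 0 (Finset.mem_range.2 (by omega)),
      Finset.sum_eq_single_of_mem 1 (Finset.mem_range.2 (by omega))]
    · simp
    · intro j _ hj; simp [hj]
    · intro i _ hi; simp [hi]

theorem seriesBoundary_seriesEE :
    seriesBoundary seriesEE =
      varX * evalAt seriesCE varY varX + varY * evalAt seriesCE varX varY
        + seriesEE * PowerSeries.subst (varX + varY) seriesPe
        - (varX + varY) * PowerSeries.subst (varX + varY) seriesPe := by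
  -- The last two terms merge into one product, whose first factor has the coefficients
  -- `bipartiteCls`.
  rw [add_sub_assoc, ← sub_mul]
  refine MvPowerSeries.ext fun m => ?_
  obtain ⟨k, l, rfl⟩ : ∃ k l, m = bidegree k l := ⟨_, _, eq_bidegree_iff.2 ⟨rfl, rfl⟩⟩
  rw [coeff_seriesBoundary_seriesEE, map_add, map_add, coeff_varX_mul, coeff_varY_mul,
    coeff_evalAt_varX_varY, coeff_evalAt_varY_varX, coeff_seriesCE, coeff_seriesCE,
    coeff_mul_bidegree]
  simp only [coeff_seriesEE_sub, coeff_subst_seriesPe]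
  by_cases h : 1 ≤ k ∧ 1 ≤ l
  · rw [if_pos h, if_pos h.1, if_pos h.2, if_pos h.1, if_pos h.2, sum_bipartiteFacetCls h.1 h.2,
      mul_comm ((l ! : ℚ)) ((k - 1)! : ℚ)]
  -- If `k` or `l` is zero both sides vanish: each of the two series terms needs one exponent
  -- positive for its variable and the other for the complete part, and in the product `i ≤ k`, `j ≤
  -- l` force `bipartiteCls i j = 0`.
  · rw [if_neg h, eq_comm, Finset.sum_eq_zero, add_zero]
    · rcases not_and_or.1 h with h | h <;> simp [h]
    · intro i hi
      refine Finset.sum_eq_zero fun j hj => ?_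
      have hi := Finset.mem_range.1 hi
      have hj := Finset.mem_range.1 hj
      rw [bipartiteCls, if_neg (by omega), smul_zero, zero_mul]

/-! ### Coefficients in the ring of simple polytopes. -/

theorem graphCls_mem {V : Type} [Fintype V] [DecidableEq V] {G : SimpleGraph V}
    (h : Finset.univ ∈ (graphicalBuildingSet G).sets) : graphCls G ∈ simplePolytopeRing :=
  cls_nestohedron_mem _ h

end Nestohedra

theorem mainTheorem3 :
    (∀ n, PowerSeries.coeff n seriesPe ∈ simplePolytopeRing) ∧
    (∀ m, MvPowerSeries.coeff m seriesCE ∈ simplePolytopeRing) ∧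
    (∀ m, MvPowerSeries.coeff m seriesEE ∈ simplePolytopeRing) ∧
    seriesBoundary seriesEE =
      varX * evalAt seriesCE varY varX + varY * evalAt seriesCE varX varY
        + seriesEE * PowerSeries.subst (varX + varY) seriesPe
        - (varX + varY) * PowerSeries.subst (varX + varY) seriesPe := by
  -- Every nonzero coefficient is a rational multiple of the class of a connected graph, whose
  -- nestohedron is simple.
  refine ⟨fun n => ?_, fun m => ?_, fun m => ?_, seriesBoundary_seriesEE⟩
  · rw [coeff_seriesPe, permutohedronCls]
    refine Subalgebra.smul_mem _ ?_ _
    split_ifs with h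
    · exact zero_mem _
    · exact graphCls_mem (mem_graphicalBuildingSet_top.2
        ⟨⟨0, Nat.pos_of_ne_zero h⟩, Finset.mem_univ _⟩)
  · rw [(eq_bidegree_iff.2 ⟨rfl, rfl⟩ : m = bidegree (m 0) (m 1)), coeff_seriesCE]
    split_ifs with h
    · exact Subalgebra.smul_mem _ (graphCls_mem (mem_graphicalBuildingSet_top_join_bot.2
        (Or.inr ⟨⟨0, h⟩, Finset.mem_univ _⟩))) _
    · exact zero_mem _
  · rw [(eq_bidegree_iff.2 ⟨rfl, rfl⟩ : m = bidegree (m 0) (m 1)), coeff_seriesEE]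
    split_ifs with h
    · exact Subalgebra.smul_mem _ (graphCls_mem (univ_mem_graphicalBuildingSet_iff.2
        ((emptyJoinEmpty_connected_iff _ _).2 h))) _
    · exact zero_mem _
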